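/- \textbf{Setting.} Use coordinates $(x,y,t)$ on $\mathbb R^{2,1}$, put $u=\frac{t+y}{2}$, $v=\frac{t-y}{2}$, and let $T^2=\mathbb R^2/2\pi\mathbb Z^2$. A \emph{Ward map} is a smooth map $J:\mathbb R^{2,1}\to SU(n)$ satisfying $$(J^{-1}J_t)_t-(J^{-1}J_x)_x-(J^{-1}J_y)_y-[J^{-1}J_t,J^{-1}J_y]=0 .$$ For $z\in\mathbb C\setminus\mathbb R$ and a Hermitian projection $\pi$ of $\mathbb C^n$ put $$h_{z,\pi}(\lambda)=(\mathrm I-\pi)+\frac{\lambda-z}{\lambda-\bar z}\,\pi .$$ Given a meromorphic map $V$ from $\mathbb C$ to the complex $n\times k$ matrices of rank $k$ (rank $k$ off a discrete closed set), let $\pi(x,y,t)$ be the Hermitian projection onto the span of the columns of $V(w)$, $w=x+zu+z^{-1}v$, extended continuously across the exceptional points. Then $h_{z,\pi}$ is the \emph{extended $1$-soliton} with pole $z$ and map $V$. It is \emph{doubly periodic} if it is $2\pi$-periodic in $x$ and in $y$ (for instance, if the entries of $V$ are elliptic functions with periods $2\pi$ and $\pi(z-z^{-1})$). The \emph{algebraic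 B\"acklund transformation} of $\psi(x,y,t,\lambda)$ by $h_{z,\pi}$ is $h_{z,\pi}*\psi=h_{z,\tilde\pi}\,\psi$, where $\tilde\pi(x,y,t)$ is the Hermitian projection onto $\psi(x,y,t,z)\,\mathrm{Im}\,\pi(x,y,t)$. Let $$\mathcal Z=\Big\{z=re^{i\theta}\in\mathbb C\setminus\mathbb R\ :\ (r=1 \text{ and } z\neq\pm i)\ \text{ or }\ \big(r\ne1\text{ and }\tfrac{\cos\theta}{r-r^{-1}}\in\mathbb Q\big)\Big\},\qquad r>0,$$ and for $z=re^{i\theta}\in\mathcal Z$ let $$T(z)=\begin{cases}\dfrac{2\pi}{\cos\theta}, & r=1,\\[2mm] \dfrac{2\pi m_2\,(r+r^{-1})}{r-r^{-1}}, & r\neq1,\ \ \dfrac{2\cos\theta}{r-r^{-1}}=\dfrac{m_1}{m_2}\ \text{ in lowest terms},\ m_2>0.\end{cases}$$ \textbf{Theorem.} Let $m\ge1$ and let $z_1,\dots,z_m\in\mathcal Z$ satisfy $z_i\neq z_j$ and $z_i\ne\bar z_j$ for all $i\neq j$. For each $i$ let $h_{z_i,\pi_i}$ be a doubly periodic extended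 $1$-soliton, given by a meromorphic map $V_i$ into the $n\times k_i$ matrices of rank $k_i$. Let $$\psi_m=h_{z_m,\pi_m}*\big(\cdots*(h_{z_2,\pi_2}*h_{z_1,\pi_1})\cdots\big),\qquad J_m=\Big(\prod_{i=1}^m\big(z_i/\bar z_i\big)^{k_i/n}\Big)\,\psi_m(\,\cdot\,,0)^{-1},$$ so that $J_m$ is obtained from the Ward map $J_1$ of $h_{z_1,\pi_1}$ by $m-1$ B\"acklund transformations; powers are principal, so the constant factor normalizes the determinant to $1$. If $T(z_j)/T(z_1)\in\mathbb Q$ for all $2\le j\le m$, then $J_m$ is a Ward map into $SU(n)$ which is triply periodic: it is $2\pi$-periodic in $x$ and in $y$, i.e. it descends to $T^2\times\mathbb R\to SU(n)$, and it is periodic in $t$. -/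

import Mathlib

open scoped ContDiff Topology ComplexConjugate

noncomputable section

namespace Ward

/-- The partial derivatives of a matrix-valued map on space-time, taken entrywise. -/
def dx {n : ℕ} (F : ℝ → ℝ → ℝ → Matrix (Fin n) (Fin n) ℂ) :
    ℝ → ℝ → ℝ → Matrix (Fin n) (Fin n) ℂ :=
  fun x y t => Matrix.of fun a b => deriv (fun s : ℝ => F s y t a b) x

def dy {n : ℕ} (F : ℝ → ℝ → ℝ → Matrix (Fin n) (Fin n) ℂ) :
    ℝ → ℝ → ℝ → Matrix (Fin n) (Fin n) ℂ :=
  fun x y t => Matrix.of fun a b => deriv (fun s : ℝ => F x s t a b) y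

def dt {n : ℕ} (F : ℝ → ℝ → ℝ → Matrix (Fin n) (Fin n) ℂ) :
    ℝ → ℝ → ℝ → Matrix (Fin n) (Fin n) ℂ :=
  fun x y t => Matrix.of fun a b => deriv (fun s : ℝ => F x y s a b) t

/-- The Ward equation
`(J⁻¹ J_t)_t - (J⁻¹ J_x)_x - (J⁻¹ J_y)_y - [J⁻¹ J_t, J⁻¹ J_y] = 0`. -/
def WardEquation {n : ℕ} (J : ℝ → ℝ → ℝ → Matrix (Fin n) (Fin n) ℂ) : Prop :=
  ∀ x y t : ℝ,
    dt (fun x y t => (J x y t)⁻¹ * dt J x y t) x y t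
      - dx (fun x y t => (J x y t)⁻¹ * dx J x y t) x y t
      - dy (fun x y t => (J x y t)⁻¹ * dy J x y t) x y t
      - ((J x y t)⁻¹ * dt J x y t * ((J x y t)⁻¹ * dy J x y t)
          - (J x y t)⁻¹ * dy J x y t * ((J x y t)⁻¹ * dt J x y t)) = 0

/-- A Ward map: a smooth `SU(n)`-valued solution of the Ward equation on `ℝ^{2,1}`. -/
structure IsWardMap {n : ℕ} (J : ℝ → ℝ → ℝ → Matrix (Fin n) (Fin n) ℂ) : Prop where
  smooth : ∀ a b : Fin n,
    ContDiff ℝ ∞ (fun p : ℝ × ℝ × ℝ => J p.1 p.2.1 p.2.2 a b)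
  mem_SU : ∀ x y t : ℝ, J x y t ∈ Matrix.specialUnitaryGroup (Fin n) ℂ
  equation : WardEquation J

/-- `2π`-periodic in each of the space variables `x`, `y`. -/
def DoublyPeriodic {n : ℕ} (F : ℝ → ℝ → ℝ → Matrix (Fin n) (Fin n) ℂ) : Prop :=
  ∀ x y t : ℝ, F (x + 2 * Real.pi) y t = F x y t ∧ F x (y + 2 * Real.pi) t = F x y t

/-- Periodic in the time variable `t`. -/
def TimePeriodic {n : ℕ} (F : ℝ → ℝ → ℝ → Matrix (Fin n) (Fin n) ℂ) : Prop :=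
  ∃ T : ℝ, 0 < T ∧ ∀ x y t : ℝ, F x y (t + T) = F x y t

/-- The Hermitian projection of `ℂ^n` onto the span of the columns (the image) of `M`. -/
def hermProj {n k : ℕ} (M : Matrix (Fin n) (Fin k) ℂ) : Matrix (Fin n) (Fin n) ℂ :=
  Matrix.toEuclideanLin.symm
    ((LinearMap.range (Matrix.toEuclideanLin M)).starProjection :
      EuclideanSpace ℂ (Fin n) →ₗ[ℂ] EuclideanSpace ℂ (Fin n))

/-- `V` is a meromorphic map from `ℂ` to the `n × k` matrices of rank `k`: the entries are
meromorphic on `ℂ`, and the rank is `k` off a discrete closed set (containing the poles). -/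
structure IsMeromorphicFrame {n k : ℕ} (V : ℂ → Matrix (Fin n) (Fin k) ℂ) : Prop where
  meromorphic : ∀ (a : Fin n) (b : Fin k) (w : ℂ), MeromorphicAt (fun ζ => V ζ a b) w
  rank_eq : ∀ w : ℂ, ∀ᶠ ζ in 𝓝[≠] w, (V ζ).rank = k

/-- The Hermitian projection onto the span of the columns of `V(w)`. The punctured limit
extends it across the poles of `V`, and makes the values of `V` on a discrete set irrelevant;
where `V` is continuous and of rank `k` it is just `hermProj (V w)`. -/
def frameProj {n k : ℕ} (V : ℂ → Matrix (Fin n) (Fin k) ℂ) (w : ℂ) :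
    Matrix (Fin n) (Fin n) ℂ :=
  Filter.limUnder (𝓝[≠] w) (fun ζ => hermProj (V ζ))

/-- `w = x + z u + z⁻¹ v` with the light-cone coordinates `u = (t+y)/2`, `v = (t-y)/2`. -/
def wCoord (z : ℂ) (x y t : ℝ) : ℂ :=
  (x : ℂ) + z * (((t + y) / 2 : ℝ) : ℂ) + z⁻¹ * (((t - y) / 2 : ℝ) : ℂ)

/-- The projection `π(x,y,t)` determined by the pole `z` and the meromorphic map `V`. -/
def solitonProj {n k : ℕ} (z : ℂ) (V : ℂ → Matrix (Fin n) (Fin k) ℂ) (x y t : ℝ) :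
    Matrix (Fin n) (Fin n) ℂ :=
  frameProj V (wCoord z x y t)

/-- `h_{z,π}(l) = π^⊥ + ((l - z)/(l - z̄)) π`. -/
def hFactor {n : ℕ} (z : ℂ) (P : Matrix (Fin n) (Fin n) ℂ) (l : ℂ) :
    Matrix (Fin n) (Fin n) ℂ :=
  (1 - P) + ((l - z) / (l - conj z)) • P

/-- The extended `1`-soliton `h_{z,π}`. -/
def extSoliton {n k : ℕ} (z : ℂ) (V : ℂ → Matrix (Fin n) (Fin k) ℂ)
    (x y t : ℝ) (l : ℂ) : Matrix (Fin n) (Fin n) ℂ :=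
  hFactor z (solitonProj z V x y t) l

/-- The algebraic Bäcklund transformation `h_{z,π} * ψ = h_{z,π̃} ψ`, where `π̃(x,y,t)` is the
Hermitian projection onto `ψ(x,y,t,z) Im π(x,y,t)`. -/
def backlund {n k : ℕ} (z : ℂ) (V : ℂ → Matrix (Fin n) (Fin k) ℂ)
    (ψ : ℝ → ℝ → ℝ → ℂ → Matrix (Fin n) (Fin n) ℂ) :
    ℝ → ℝ → ℝ → ℂ → Matrix (Fin n) (Fin n) ℂ :=
  fun x y t l => hFactor z (hermProj (ψ x y t z * solitonProj z V x y t)) l * ψ x y t l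

/-- `multiPsi z V N = h_{z_N,π_N} * (⋯ * (h_{z_1,π_1} * h_{z_0,π_0}))`: the extended
`1`-soliton with index `0`, followed by `N` Bäcklund transformations. -/
def multiPsi {n : ℕ} (z : ℕ → ℂ) {k : ℕ → ℕ} (V : (i : ℕ) → ℂ → Matrix (Fin n) (Fin (k i)) ℂ) :
    ℕ → ℝ → ℝ → ℝ → ℂ → Matrix (Fin n) (Fin n) ℂ
  | 0 => extSoliton (z 0) (V 0)
  | N + 1 => backlund (z (N + 1)) (V (N + 1)) (multiPsi z V N)

/-- The Ward map `ψ(·,0)⁻¹` associated to `multiPsi z V N`, with the factors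
`(z_i / z̄_i)^{k_i / n}` that normalize the determinant to `1`. -/
def multiWard {n : ℕ} (z : ℕ → ℂ) {k : ℕ → ℕ} (V : (i : ℕ) → ℂ → Matrix (Fin n) (Fin (k i)) ℂ)
    (N : ℕ) (x y t : ℝ) : Matrix (Fin n) (Fin n) ℂ :=
  (∏ i ∈ Finset.range (N + 1), (z i / conj (z i)) ^ ((k i : ℂ) / (n : ℂ))) •
    (multiPsi z V N x y t 0)⁻¹

/-- The set `𝒵` of non-real `z = r e^{iθ}` with `r = 1` and `z ≠ ± i`, or with `r ≠ 1` and
`cos θ / (r - r⁻¹)` rational. -/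
def poleSet : Set ℂ :=
  {z | z.im ≠ 0 ∧
    ((‖z‖ = 1 ∧ z ≠ Complex.I ∧ z ≠ -Complex.I) ∨
      (‖z‖ ≠ 1 ∧ ∃ q : ℚ, Real.cos z.arg / (‖z‖ - ‖z‖⁻¹) = (q : ℝ)))}

open Classical in
/-- The period function: `T(z) = 2π / cos θ` if `r = 1`, and
`T(z) = 2π m₂ (r + r⁻¹) / (r - r⁻¹)` if `r ≠ 1` and `2 cos θ / (r - r⁻¹) = m₁ / m₂` in lowest
terms with `m₂ > 0`. (The value off `𝒵` is irrelevant.) -/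
def timePeriod (z : ℂ) : ℝ :=
  if ‖z‖ = 1 then 2 * Real.pi / Real.cos z.arg
  else if h : ∃ q : ℚ, 2 * Real.cos z.arg / (‖z‖ - ‖z‖⁻¹) = (q : ℝ) then
    2 * Real.pi * ((Classical.choose h).den : ℝ) * (‖z‖ + ‖z‖⁻¹) / (‖z‖ - ‖z‖⁻¹)
  else 0

end Ward

end

namespace Ward

open Matrix
open scoped Matrix.Norms.L2Operator

/-! Periodicity and the Ward equation are separate matters. Since w = x + (t/2)(z + 1/z) + (y/2)(z -
1/z), shifting t by T(z) moves w exactly as a vector of 2πℤ² in (x, y) does; this is what the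
condition defining `poleSet` provides (`timePeriod_spec`). A doubly periodic soliton projection
therefore has time period T(z). The iterated transformation at a point depends only on the
projections at that point (`multiPsi_congr`), so it inherits their space periods and any common
multiple of the T(z_j), which exists because the quotients are rational.

For the Ward equation one carries along a linear system (λ∂_x - ∂_u)ψ = Q_x ψ, (λ∂_v - ∂_x)ψ = Q_v ψ
with a single skew-Hermitian potential Q. Bäcklund transformation preserves it and replaces Q by Q -
(z - z̄)π̃ (`IsExtendedSolution.backlund`). The reason is that π̃ projects onto the image of
ψ(z)e(w) with e holomorphic, and both operators annihilate e(w) at λ = z. At λ = 0 the system says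
J⁻¹J_u = Q_x and J⁻¹J_x = Q_v, and Q_xv = Q_vx is the Ward equation (`wardEquation_of_potential`).
Smoothness across poles and rank drops comes from writing the image of V locally as the image of a
holomorphic idempotent (`exists_holomorphic_idempotent`). -/

/-! ### Hermitian projections as algebraic expressions -/

/-- If `M` and `M'` are right multiples of each other, they have the same Hermitian projection. -/
theorem hermProj_eq_of_mul {n k l : ℕ} {M : Matrix (Fin n) (Fin k) ℂ}
    {M' : Matrix (Fin n) (Fin l) ℂ} (A : Matrix (Fin k) (Fin l) ℂ) (B : Matrix (Fin l) (Fin k) ℂ)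
    (hA : M' = M * A) (hB : M = M' * B) : hermProj M = hermProj M' := by
  have key : ∀ {k l : ℕ} (M : Matrix (Fin n) (Fin k) ℂ) (A : Matrix (Fin k) (Fin l) ℂ),
      LinearMap.range (Matrix.toEuclideanLin (M * A)) ≤ LinearMap.range (Matrix.toEuclideanLin M) := by
    rintro k l M A _ ⟨v, rfl⟩
    refine ⟨WithLp.toLp 2 (A *ᵥ v.ofLp), ?_⟩
    simp [Matrix.toLpLin_apply, Matrix.mulVec_mulVec]
  have h : LinearMap.range (Matrix.toEuclideanLin M) = LinearMap.range (Matrix.toEuclideanLin M') :=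
    le_antisymm (by conv_lhs => rw [hB]
                    exact key _ _) (by rw [hA]; exact key _ _)
  simp only [hermProj, h]

/-- A Hermitian matrix fixing the columns of `M` and factoring through `M` is its projection. -/
theorem hermProj_eq {n k : ℕ} {M : Matrix (Fin n) (Fin k) ℂ} {P : Matrix (Fin n) (Fin n) ℂ}
    (X : Matrix (Fin k) (Fin n) ℂ) (hP : P = M * X) (hPM : P * M = M) (hH : Pᴴ = P) :
    hermProj M = P := by
  unfold hermProj
  rw [LinearEquiv.symm_apply_eq]
  ext1 v
  refine Submodule.eq_starProjection_of_mem_of_inner_eq_zero ?_ ?_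
  · refine ⟨WithLp.toLp 2 (X *ᵥ v.ofLp), ?_⟩
    simp [Matrix.toLpLin_apply, Matrix.mulVec_mulVec, hP]
  · rintro _ ⟨w, rfl⟩
    rw [EuclideanSpace.inner_eq_star_dotProduct, dotProduct_comm]
    simp only [Matrix.toLpLin_apply, WithLp.ofLp_sub]
    rw [star_sub, sub_dotProduct, Matrix.star_mulVec, ← Matrix.dotProduct_mulVec, hH,
      Matrix.mulVec_mulVec, hPM, sub_self]

/-- The Gram matrix entering the formula for the projection onto the image of `g * e`. -/
noncomputable def gram {n : ℕ} (g e : Matrix (Fin n) (Fin n) ℂ) : Matrix (Fin n) (Fin n) ℂ :=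
  (g * e)ᴴ * (g * e) + (1 - e)ᴴ * (1 - e)

-- `g * e` may have dependent columns, so its own Gram matrix is only semidefinite; the summand from
-- `1 - e` repairs this. A kernel vector v is killed by both `g * e` and `1 - e`, so e v = v and g v
-- = 0.
open scoped ComplexOrder in
theorem isUnit_gram {n : ℕ} {g e : Matrix (Fin n) (Fin n) ℂ} (hg : IsUnit g) :
    IsUnit (gram g e) := by
  rw [← Matrix.mulVec_injective_iff_isUnit, ← Matrix.coe_mulVecLin, ← LinearMap.ker_eq_bot,
    LinearMap.ker_eq_bot']
  intro v hv
  rw [Matrix.mulVecLin_apply] at hv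
  have h0 : star ((g * e) *ᵥ v) ⬝ᵥ ((g * e) *ᵥ v)
      + star ((1 - e) *ᵥ v) ⬝ᵥ ((1 - e) *ᵥ v) = 0 := by
    rw [Matrix.star_mulVec, Matrix.star_mulVec, ← Matrix.dotProduct_mulVec,
      ← Matrix.dotProduct_mulVec, Matrix.mulVec_mulVec, Matrix.mulVec_mulVec, ← dotProduct_add,
      ← Matrix.add_mulVec]
    exact (congrArg (fun w => star v ⬝ᵥ w) hv).trans (dotProduct_zero _)
  have h1 : (0 : ℂ) ≤ star ((g * e) *ᵥ v) ⬝ᵥ ((g * e) *ᵥ v) := dotProduct_star_self_nonneg _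
  have h2 : (0 : ℂ) ≤ star ((1 - e) *ᵥ v) ⬝ᵥ ((1 - e) *ᵥ v) := dotProduct_star_self_nonneg _
  obtain ⟨h3, h4⟩ := (add_eq_zero_iff_of_nonneg h1 h2).1 h0
  rw [dotProduct_star_self_eq_zero] at h3 h4
  have h5 : e *ᵥ v = v := by
    rw [Matrix.sub_mulVec, Matrix.one_mulVec, sub_eq_zero] at h4
    exact h4.symm
  rw [← Matrix.mulVec_mulVec, h5] at h3
  exact Matrix.mulVec_injective_of_isUnit hg (by simpa using h3)

/-- The summand added for invertibility disappears against e. Hence M(MᴴM)⁻¹Mᴴ survives for M = g e,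
with `gram g e` in place of MᴴM. -/
theorem gram_mul {n : ℕ} {g e : Matrix (Fin n) (Fin n) ℂ} (he : e * e = e) :
    gram g e * e = (g * e)ᴴ * (g * e) := by
  have h : (1 - e) * e = 0 := by rw [sub_mul, he, one_mul, sub_self]
  rw [gram, add_mul, mul_assoc (1 - e)ᴴ, h, mul_zero, add_zero, mul_assoc, mul_assoc g, he]

theorem gram_conjTranspose {n : ℕ} (g e : Matrix (Fin n) (Fin n) ℂ) : (gram g e)ᴴ = gram g e := by
  simp [gram, Matrix.conjTranspose_mul]

theorem gram_inv_mul {n : ℕ} {g e : Matrix (Fin n) (Fin n) ℂ} (hg : IsUnit g) (he : e * e = e) :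
    (gram g e)⁻¹ * (g * e)ᴴ * (g * e) = e := by
  rw [mul_assoc, ← gram_mul he, ← mul_assoc,
    Matrix.nonsing_inv_mul _ ((Matrix.isUnit_iff_isUnit_det _).1 (isUnit_gram hg)), one_mul]

/-- The projection onto the image of `g * e`, for an invertible `g` and an idempotent `e`. -/
theorem hermProj_mul_idempotent {n : ℕ} {g e : Matrix (Fin n) (Fin n) ℂ} (hg : IsUnit g)
    (he : e * e = e) : hermProj (g * e) = (g * e) * (gram g e)⁻¹ * (g * e)ᴴ := by
  refine hermProj_eq ((gram g e)⁻¹ * (g * e)ᴴ) (mul_assoc _ _ _) ?_ ?_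
  · rw [mul_assoc (g * e), mul_assoc (g * e), gram_inv_mul hg he, mul_assoc, he]
  · simp only [Matrix.conjTranspose_mul, Matrix.conjTranspose_nonsing_inv, gram_conjTranspose,
      Matrix.conjTranspose_conjTranspose, mul_assoc]

/-- The algebraic properties of the projection onto the image of `g * e`. -/
theorem hermProj_mul_idempotent_properties {n : ℕ} {g e : Matrix (Fin n) (Fin n) ℂ} (hg : IsUnit g)
    (he : e * e = e) :
    (hermProj (g * e))ᴴ = hermProj (g * e) ∧
    hermProj (g * e) * (g * e) = g * e ∧
    (∃ X, hermProj (g * e) = g * e * X) ∧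
    hermProj (g * e) * hermProj (g * e) = hermProj (g * e) ∧
    ∀ c : ℂ, (1 + c • hermProj (g * e)).det = (1 + c • e).det := by
  have h := hermProj_mul_idempotent hg he
  have h1 : hermProj (g * e) * (g * e) = g * e := by
    rw [h, mul_assoc (g * e), mul_assoc (g * e), gram_inv_mul hg he, mul_assoc, he]
  have h2 : hermProj (g * e) = g * e * ((gram g e)⁻¹ * (g * e)ᴴ) := by rw [h, mul_assoc]
  refine ⟨?_, h1, ⟨_, h2⟩, ?_, fun c => ?_⟩
  · simp only [h, Matrix.conjTranspose_mul, Matrix.conjTranspose_nonsing_inv, gram_conjTranspose,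
      Matrix.conjTranspose_conjTranspose, mul_assoc]
  · conv_lhs => rw [h2, ← mul_assoc, ← h2, h1]
    exact h2.symm
  -- Sylvester's identity exchanges the two factors of the projection; in the other order their
  -- product is e.
  · rw [h2, ← mul_smul_comm, Matrix.det_one_add_mul_comm, smul_mul_assoc, gram_inv_mul hg he]

theorem hermProj_idempotent_properties {n : ℕ} {e : Matrix (Fin n) (Fin n) ℂ}
    (he : e * e = e) : hermProj e * e = e ∧ ∃ X, hermProj e = e * X := by
  have h := hermProj_mul_idempotent_properties (g := 1) isUnit_one he
  rw [one_mul] at h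
  exact ⟨h.2.1, h.2.2.1⟩

/-- An idempotent and its Hermitian projection have the same image. This lets a holomorphic
idempotent replace the projection π, which is not holomorphic, inside π̃. -/
theorem hermProj_mul_hermProj {n : ℕ} (g : Matrix (Fin n) (Fin n) ℂ) {e : Matrix (Fin n) (Fin n) ℂ}
    (he : e * e = e) : hermProj (g * hermProj e) = hermProj (g * e) := by
  obtain ⟨h1, X, hX⟩ := hermProj_idempotent_properties he
  refine hermProj_eq_of_mul e X ?_ ?_
  · rw [mul_assoc, h1]
  · rw [mul_assoc, ← hX]

/-! ### Minors, and smooth dependence of projections -/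

/-- A matrix of full column rank has an invertible square submatrix of rows. -/
theorem exists_det_submatrix_ne_zero {n k : ℕ} {M : Matrix (Fin n) (Fin k) ℂ} (h : M.rank = k) :
    ∃ s : Fin k → Fin n, (M.submatrix s id).det ≠ 0 := by
  have h1 : Submodule.span ℂ (Set.range M.row) = ⊤ := by
    apply Submodule.eq_top_of_finrank_eq
    rw [← Matrix.rank_eq_finrank_span_row, h]; simp
  obtain ⟨κ, a, -, hspan, hli⟩ := exists_linearIndependent' ℂ M.row
  have hb : Submodule.span ℂ (Set.range (M.row ∘ a)) = ⊤ := hspan.trans h1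
  let b := Module.Basis.mk hli hb.ge
  have : Fintype κ := FiniteDimensional.fintypeBasisIndex b
  have hc : Fintype.card κ = k := by
    rw [← Module.finrank_eq_card_basis b]; simp
  let f : Fin k ≃ κ := (Fintype.equivFinOfCardEq hc).symm
  refine ⟨a ∘ f, ?_⟩
  have h2 : LinearIndependent ℂ (M.submatrix (a ∘ f) id).row := hli.comp f f.injective
  exact ((Matrix.isUnit_iff_isUnit_det _).1 (Matrix.linearIndependent_rows_iff_isUnit.1 h2)).ne_zero

/-- A map into matrices is the sum of its entries times the matrix units. -/
theorem eq_sum_smul_single {X : Type*} {n : ℕ} (F : X → Matrix (Fin n) (Fin n) ℂ) :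
    F = fun p => ∑ i, ∑ j, F p i j • Matrix.single i j (1 : ℂ) := by
  funext p
  conv_lhs => rw [Matrix.matrix_eq_sum_single (F p)]
  simp

theorem analyticAt_of_entries {n : ℕ} {F : ℂ → Matrix (Fin n) (Fin n) ℂ} {w : ℂ}
    (h : ∀ i j, AnalyticAt ℂ (fun ζ => F ζ i j) w) : AnalyticAt ℂ F w := by
  rw [eq_sum_smul_single F]
  exact Finset.analyticAt_fun_sum _ fun i _ => Finset.analyticAt_fun_sum _ fun j _ =>
    (h i j).smul analyticAt_const

theorem contDiff_entry {n : ℕ} {X : Type*} [NormedAddCommGroup X] [NormedSpace ℝ X]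
    {F : X → Matrix (Fin n) (Fin n) ℂ} (h : ContDiff ℝ ∞ F) (i j : Fin n) :
    ContDiff ℝ ∞ (fun p => F p i j) :=
  (LinearMap.toContinuousLinearMap (Matrix.entryLinearMap ℝ ℂ i j)).contDiff.comp h

/-- Smoothness of the inverse matrix. -/
theorem contDiffAt_matrix_inv {n : ℕ} {X : Type*} [NormedAddCommGroup X] [NormedSpace ℝ X]
    {F : X → Matrix (Fin n) (Fin n) ℂ} {p : X} (h : ContDiffAt ℝ ∞ F p) (hu : IsUnit (F p)) :
    ContDiffAt ℝ ∞ (fun q => (F q)⁻¹) p := by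
  obtain ⟨U, hU⟩ := hu
  have h1 := contDiffAt_ringInverse ℝ (n := ∞) U
  rw [hU] at h1
  simp only [Matrix.nonsing_inv_eq_ringInverse]
  exact h1.comp p h

theorem contDiffAt_conjTranspose {n : ℕ} {X : Type*} [NormedAddCommGroup X] [NormedSpace ℝ X]
    {F : X → Matrix (Fin n) (Fin n) ℂ} {p : X} (h : ContDiffAt ℝ ∞ F p) :
    ContDiffAt ℝ ∞ (fun q => (F q)ᴴ) p :=
  (starL' ℝ : Matrix (Fin n) (Fin n) ℂ ≃L[ℝ] _).contDiff.contDiffAt.comp p h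

/-- Smoothness of the projection onto the image of a smooth family. -/
theorem contDiffAt_hermProj {n : ℕ} {X : Type*} [NormedAddCommGroup X] [NormedSpace ℝ X]
    {g e : X → Matrix (Fin n) (Fin n) ℂ} {p : X} (hg : ContDiffAt ℝ ∞ g p)
    (he : ContDiffAt ℝ ∞ e p) (hgu : ∀ q, IsUnit (g q)) (hee : ∀ᶠ q in 𝓝 p, e q * e q = e q) :
    ContDiffAt ℝ ∞ (fun q => hermProj (g q * e q)) p := by
  have h1 : ContDiffAt ℝ ∞ (fun q => g q * e q) p := hg.mul he
  have h2 : ContDiffAt ℝ ∞ (fun q => 1 - e q) p := contDiffAt_const.sub he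
  have h3 : ContDiffAt ℝ ∞ (fun q => gram (g q) (e q)) p :=
    ((contDiffAt_conjTranspose h1).mul h1).add ((contDiffAt_conjTranspose h2).mul h2)
  have h4 := (h1.mul (contDiffAt_matrix_inv h3 (isUnit_gram (hgu p)))).mul
    (contDiffAt_conjTranspose h1)
  refine h4.congr_of_eventuallyEq ?_
  filter_upwards [hee] with q hq
  exact hermProj_mul_idempotent (hgu q) hq

/-! ### Meromorphic frames across exceptional points -/

/-- Cramer's rule for the reduced form of a matrix with an invertible square block of rows. -/
theorem cramer_submatrix_mul {n k : ℕ} (M : Matrix (Fin n) (Fin k) ℂ) (s : Fin k → Fin n)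
    (h : (M.submatrix s id).det ≠ 0) :
    (Matrix.of fun a b => (M.submatrix (Function.update s b a) id).det / (M.submatrix s id).det)
      * M.submatrix s id = M := by
  ext a c
  have h1 := congrFun (Matrix.mulVec_cramer (M.submatrix s id)ᵀ (M a)) c
  have h2 : ∀ b, Matrix.cramer (M.submatrix s id)ᵀ (M a) b
      = (M.submatrix (Function.update s b a) id).det := by
    intro b
    rw [Matrix.cramer_apply, Matrix.updateCol_transpose, Matrix.det_transpose]
    congr 1
    ext i j
    by_cases hi : i = b
    · subst hi; simp
    · simp [hi]
  simp only [Matrix.mulVec, dotProduct, h2, Matrix.transpose_apply, Matrix.det_transpose,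
    Pi.smul_apply, smul_eq_mul] at h1
  rw [Matrix.mul_apply]
  simp only [Matrix.of_apply]
  rw [← mul_right_inj' h, ← h1, Finset.mul_sum]
  refine Finset.sum_congr rfl fun b _ => ?_
  field_simp

theorem meromorphicAt_det_submatrix {n k : ℕ} {V : ℂ → Matrix (Fin n) (Fin k) ℂ} {w : ℂ}
    (hV : ∀ a b, MeromorphicAt (fun ζ => V ζ a b) w) (s : Fin k → Fin n) :
    MeromorphicAt (fun ζ => ((V ζ).submatrix s id).det) w := by
  simp only [Matrix.det_apply']
  refine MeromorphicAt.fun_sum fun σ _ => ?_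
  exact (MeromorphicAt.const _ _).fun_mul (MeromorphicAt.fun_prod fun i _ => hV _ _)

/-- Near every point the image of a meromorphic frame is the image of a holomorphic family of
idempotents, also across the exceptional points. -/
theorem exists_holomorphic_idempotent {n k : ℕ} {V : ℂ → Matrix (Fin n) (Fin k) ℂ}
    (hV : IsMeromorphicFrame V) (w : ℂ) :
    ∃ e : ℂ → Matrix (Fin n) (Fin n) ℂ, AnalyticAt ℂ e w ∧
      (∀ᶠ ζ in 𝓝 w, e ζ * e ζ = e ζ) ∧
      (∀ᶠ ζ in 𝓝 w, ∀ c : ℂ, (1 + c • e ζ).det = (1 + c) ^ k) ∧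
      ∀ᶠ ζ in 𝓝[≠] w, hermProj (V ζ) = hermProj (e ζ) := by
  have hm := fun s => meromorphicAt_det_submatrix (fun a b => hV.meromorphic a b w) s
  set D : (Fin k → Fin n) → ℂ → ℂ := fun s ζ => ((V ζ).submatrix s id).det
  -- If every minor vanished identically near w, the rank would be less than k at some nearby point.
  obtain ⟨s₀, hs₀⟩ : ∃ s, meromorphicOrderAt (D s) w ≠ ⊤ := by
    by_contra! hcon
    simp only [meromorphicOrderAt_eq_top_iff] at hcon
    obtain ⟨ζ, h1, h2⟩ := ((Filter.eventually_all.2 hcon).and (hV.rank_eq w)).exists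
    obtain ⟨s, hs⟩ := exists_det_submatrix_ne_zero h2
    exact hs (h1 s)
  have : Nonempty (Fin k → Fin n) := ⟨s₀⟩
  -- Dividing by a minor of least order at w leaves quotients of nonnegative order, so all
  -- singularities at w are removable.
  obtain ⟨s, hs⟩ := Finite.exists_min fun s => meromorphicOrderAt (D s) w
  have hst : meromorphicOrderAt (D s) w ≠ ⊤ := ne_top_of_le_ne_top hs₀ (hs s₀)
  have hne : ∀ᶠ ζ in 𝓝[≠] w, D s ζ ≠ 0 := (meromorphicOrderAt_ne_top_iff_eventually_ne_zero
    (hm s)).1 hst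
  let g : Fin n → Fin k → ℂ → ℂ := fun a b ζ => D (Function.update s b a) ζ / D s ζ
  have hg : ∀ a b, MeromorphicAt (g a b) w := fun a b => (hm _).fun_div (hm _)
  have hg0 : ∀ a b, 0 ≤ meromorphicOrderAt (g a b) w := by
    intro a b
    have h1 : meromorphicOrderAt (g a b) w
        = meromorphicOrderAt (D (Function.update s b a)) w - meromorphicOrderAt (D s) w :=
      meromorphicOrderAt_div (hm _) (hm _)
    rw [h1]
    have h2 := hs (Function.update s b a)
    revert h2 hst
    generalize meromorphicOrderAt (D s) w = p
    generalize meromorphicOrderAt (D (Function.update s b a)) w = q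
    intro hp hpq
    lift p to ℤ using hp
    induction q using WithTop.recTopCoe with
    | top => simp
    | coe q => 
      have : p ≤ q := by exact_mod_cast hpq
      have : 0 ≤ q - p := by lia
      exact_mod_cast this
  let G : ℂ → Matrix (Fin n) (Fin k) ℂ := fun ζ => Matrix.of fun a b => toMeromorphicNFAt (g a b) w ζ
  have hGa : ∀ a b, AnalyticAt ℂ (fun ζ => G ζ a b) w := fun a b =>
    (hg a b).meromorphicOrderAt_nonneg_iff_analyticAt_toMeromorphicNFAt.1 (hg0 a b)
  have hGg : ∀ᶠ ζ in 𝓝[≠] w, G ζ = Matrix.of fun a b => g a b ζ := by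
    have : ∀ᶠ ζ in 𝓝[≠] w, ∀ a b, g a b ζ = toMeromorphicNFAt (g a b) w ζ :=
      Filter.eventually_all.2 fun a => Filter.eventually_all.2 fun b =>
        (hg a b).eq_nhdsNE_toMeromorphicNFAt
    filter_upwards [this] with ζ hζ
    ext a b
    exact (hζ a b).symm
  have hGV : ∀ᶠ ζ in 𝓝[≠] w, G ζ * (V ζ).submatrix s id = V ζ := by
    filter_upwards [hGg, hne] with ζ h1 h2
    rw [h1]
    exact cramer_submatrix_mul (V ζ) s h2
  let R : Matrix (Fin k) (Fin n) ℂ := (1 : Matrix (Fin n) (Fin n) ℂ).submatrix s id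
  have hR : ∀ M : Matrix (Fin n) (Fin k) ℂ, R * M = M.submatrix s id := by
    intro M
    ext a b
    simp [R, Matrix.mul_apply, Matrix.one_apply]
  -- R picks the rows s, on which G is the identity: off w by cancelling the invertible block of V,
  -- at w by continuity.
  have hRG : ∀ᶠ ζ in 𝓝 w, R * G ζ = 1 := by
    have h1 : ∀ a b, ∀ᶠ ζ in 𝓝 w, G ζ (s a) b = (1 : Matrix (Fin k) (Fin k) ℂ) a b := by
      intro a b
      refine (ContinuousAt.eventuallyEq_nhds_iff_eventuallyEq_nhdsNE (hGa _ _).continuousAt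
        continuousAt_const).1 ?_
      filter_upwards [hGV, hne] with ζ h2 h3
      have h4 : (R * G ζ) * (V ζ).submatrix s id = 1 * (V ζ).submatrix s id := by
        rw [Matrix.mul_assoc, h2, hR, Matrix.one_mul]
      have h5 := (Matrix.isUnit_iff_isUnit_det _).2 (isUnit_iff_ne_zero.2 h3)
      have h6 := h5.mul_right_cancel h4
      rw [hR] at h6
      exact congrFun (congrFun h6 a) b
    have h2 := Filter.eventually_all.2 fun a => Filter.eventually_all.2 (h1 a)
    filter_upwards [h2] with ζ hζ
    rw [hR]
    ext a b
    exact hζ a b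
  -- RG = 1 makes GR idempotent with the image of G, which is that of V off w; it also reduces the
  -- determinant to that of a k × k scalar matrix.
  refine ⟨fun ζ => G ζ * R, analyticAt_of_entries fun i j => ?_, ?_, ?_, ?_⟩
  · simp only [Matrix.mul_apply]
    exact Finset.analyticAt_fun_sum _ fun b _ => (hGa i b).mul analyticAt_const
  · filter_upwards [hRG] with ζ hζ
    rw [Matrix.mul_assoc, ← Matrix.mul_assoc R, hζ, Matrix.one_mul]
  · filter_upwards [hRG] with ζ hζ c
    rw [← Matrix.smul_mul, Matrix.det_one_add_mul_comm, Matrix.mul_smul, hζ]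
    rw [show (1 : Matrix (Fin k) (Fin k) ℂ) + c • 1 = (1 + c) • 1 by rw [add_smul, one_smul],
      Matrix.det_smul]
    simp
  · filter_upwards [hGV, hRG.filter_mono nhdsWithin_le_nhds, hne] with ζ h1 h2 h3
    have h5 : IsUnit ((V ζ).submatrix s id).det := isUnit_iff_ne_zero.2 h3
    refine hermProj_eq_of_mul (((V ζ).submatrix s id)⁻¹ * R) (V ζ) ?_ ?_
    · have h6 : G ζ = V ζ * ((V ζ).submatrix s id)⁻¹ := by
        conv_rhs => rw [← h1, Matrix.mul_assoc]
        rw [h1, Matrix.mul_nonsing_inv _ h5, Matrix.mul_one]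
      rw [h6, Matrix.mul_assoc]
    · rw [Matrix.mul_assoc, hR, h1]

/-- Near every point `frameProj V` is the projection onto the image of a holomorphic family of
idempotents. -/
theorem exists_frameProj_eq {n k : ℕ} {V : ℂ → Matrix (Fin n) (Fin k) ℂ}
    (hV : IsMeromorphicFrame V) (w : ℂ) :
    ∃ e : ℂ → Matrix (Fin n) (Fin n) ℂ, AnalyticAt ℂ e w ∧
      ∀ᶠ ζ in 𝓝 w, e ζ * e ζ = e ζ ∧ (∀ c : ℂ, (1 + c • e ζ).det = (1 + c) ^ k) ∧
        frameProj V ζ = hermProj (e ζ) := by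
  obtain ⟨e, hea, hee, hdet, hVe⟩ := exists_holomorphic_idempotent hV w
  refine ⟨e, hea, ?_⟩
  have h1 : ∀ᶠ ζ in 𝓝 w, ∀ᶠ ξ in 𝓝[≠] ζ, hermProj (V ξ) = hermProj (e ξ) := by
    have h2 : ∀ᶠ ζ in 𝓝 w, ζ ≠ w → ∀ᶠ ξ in 𝓝 ζ, hermProj (V ξ) = hermProj (e ξ) := by
      rw [eventually_nhdsWithin_iff] at hVe
      filter_upwards [hVe.eventually_nhds] with ζ hζ hne
      filter_upwards [hζ, isOpen_ne.mem_nhds hne] with ξ h3 h4 using h3 h4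
    filter_upwards [h2] with ζ hζ
    by_cases h : ζ = w
    · rw [h]; exact hVe
    · exact (hζ h).filter_mono nhdsWithin_le_nhds
  filter_upwards [h1, hee, hdet, hee.eventually_nhds, hea.eventually_analyticAt]
    with ζ h1 h2 h3 h4 h5
  refine ⟨h2, h3, ?_⟩
  -- Continuity of the projection onto the image of e identifies the punctured limit in `frameProj`
  -- with its value at ζ.
  have h6 : ContDiffAt ℝ ∞ (fun ξ => hermProj (1 * e ξ)) ζ :=
    contDiffAt_hermProj contDiffAt_const (h5.contDiffAt.restrict_scalars ℝ) (fun _ => isUnit_one) h4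
  simp only [one_mul] at h6
  refine Filter.Tendsto.limUnder_eq ?_
  refine (h6.continuousAt.tendsto.mono_left nhdsWithin_le_nhds).congr' ?_
  filter_upwards [h1] with ξ hξ using hξ.symm

/-! ### Directional derivatives on space-time -/

/-- The derivative of a matrix-valued map on space-time in a constant direction. -/
noncomputable def dirDeriv {n : ℕ} (v : ℝ × ℝ × ℝ) (F : ℝ × ℝ × ℝ → Matrix (Fin n) (Fin n) ℂ) :
    ℝ × ℝ × ℝ → Matrix (Fin n) (Fin n) ℂ :=
  fun p => fderiv ℝ F p v

section DirDeriv

variable {n : ℕ} {F G : ℝ × ℝ × ℝ → Matrix (Fin n) (Fin n) ℂ} {p v w : ℝ × ℝ × ℝ}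

theorem dirDeriv_mul (hF : DifferentiableAt ℝ F p) (hG : DifferentiableAt ℝ G p) :
    dirDeriv v (fun q => F q * G q) p = dirDeriv v F p * G p + F p * dirDeriv v G p := by
  unfold dirDeriv
  rw [fderiv_fun_mul' hF hG]
  simp [add_comm]

theorem dirDeriv_const_smul (c : ℂ) (hF : DifferentiableAt ℝ F p) :
    dirDeriv v (fun q => c • F q) p = c • dirDeriv v F p := by
  unfold dirDeriv
  rw [fderiv_fun_const_smul hF]
  simp

theorem dirDeriv_sub (hF : DifferentiableAt ℝ F p) (hG : DifferentiableAt ℝ G p) :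
    dirDeriv v (fun q => F q - G q) p = dirDeriv v F p - dirDeriv v G p := by
  unfold dirDeriv
  rw [fderiv_fun_sub hF hG]
  simp

theorem dirDeriv_conjTranspose (hF : DifferentiableAt ℝ F p) :
    dirDeriv v (fun q => (F q)ᴴ) p = (dirDeriv v F p)ᴴ := by
  have h := ((starL' ℝ : Matrix (Fin n) (Fin n) ℂ ≃L[ℝ] _).hasFDerivAt.comp p hF.hasFDerivAt)
  exact congrArg (fun L => L v) h.fderiv

theorem dirDeriv_congr (h : F =ᶠ[𝓝 p] G) : dirDeriv v F p = dirDeriv v G p := by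
  unfold dirDeriv
  rw [h.fderiv_eq]

theorem dirDeriv_const (A : Matrix (Fin n) (Fin n) ℂ) : dirDeriv v (fun _ => A) p = 0 := by
  simp [dirDeriv]

theorem dirDeriv_add_dir : dirDeriv (v + w) F p = dirDeriv v F p + dirDeriv w F p :=
  map_add _ _ _

theorem dirDeriv_sub_dir : dirDeriv (v - w) F p = dirDeriv v F p - dirDeriv w F p :=
  map_sub _ _ _

theorem contDiff_dirDeriv (hF : ContDiff ℝ ∞ F) (v : ℝ × ℝ × ℝ) : ContDiff ℝ ∞ (dirDeriv v F) :=
  (hF.fderiv_right (m := ∞) le_rfl).clm_apply contDiff_const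

theorem _root_.ContDiff.differentiableAt_of_infty {X Y : Type*} [NormedAddCommGroup X]
    [NormedSpace ℝ X] [NormedAddCommGroup Y] [NormedSpace ℝ Y] {f : X → Y} (h : ContDiff ℝ ∞ f)
    {x : X} : DifferentiableAt ℝ f x :=
  h.contDiffAt.differentiableAt (by simp)

theorem dirDeriv_comm (hF : ContDiff ℝ ∞ F) :
    dirDeriv v (dirDeriv w F) p = dirDeriv w (dirDeriv v F) p := by
  have h1 : DifferentiableAt ℝ (fderiv ℝ F) p :=
    (hF.fderiv_right (m := ∞) le_rfl).differentiableAt_of_infty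
  have h2 : ∀ a b, dirDeriv a (dirDeriv b F) p = fderiv ℝ (fderiv ℝ F) p a b := by
    intro a b
    have := h1.hasFDerivAt.clm_apply (hasFDerivAt_const b p)
    refine (congrArg (fun L => L a) this.fderiv).trans ?_
    simp
  rw [h2, h2]
  exact second_derivative_symmetric (fun y => hF.differentiableAt_of_infty.hasFDerivAt)
    h1.hasFDerivAt v w

end DirDeriv

/-- The coordinate `w` as a real linear map on space-time. -/
noncomputable def wCoordL (z : ℂ) : ℝ × ℝ × ℝ →L[ℝ] ℂ :=
  LinearMap.toContinuousLinearMap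
    { toFun := fun p => wCoord z p.1 p.2.1 p.2.2
      map_add' := fun p q => by simp only [wCoord, Prod.fst_add, Prod.snd_add]; push_cast; ring
      map_smul' := fun c p => by
        simp only [wCoord, Prod.smul_fst, Prod.smul_snd, smul_eq_mul, RingHom.id_apply,
          Complex.real_smul]
        push_cast; ring }

theorem wCoordL_apply (z : ℂ) (p : ℝ × ℝ × ℝ) : wCoordL z p = wCoord z p.1 p.2.1 p.2.2 := rfl

/-- The derivative of e is complex linear, so a direction enters only through its w-value. As these
are 1, z, z⁻¹ on ∂_x, ∂_u, ∂_v, both z∂_x - ∂_u and z∂_v - ∂_x annihilate e(w). -/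
theorem dirDeriv_comp_wCoordL {n : ℕ} {z : ℂ} {e : ℂ → Matrix (Fin n) (Fin n) ℂ}
    {p : ℝ × ℝ × ℝ} (he : DifferentiableAt ℂ e (wCoordL z p)) (v : ℝ × ℝ × ℝ) :
    dirDeriv v (fun q => e (wCoordL z q)) p = wCoordL z v • fderiv ℂ e (wCoordL z p) 1 := by
  have h := (he.hasFDerivAt.restrictScalars ℝ).comp p (wCoordL z).hasFDerivAt
  refine (congrArg (fun L => L v) h.fderiv).trans ?_
  simp only [ContinuousLinearMap.comp_apply, ContinuousLinearMap.coe_restrictScalars']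
  rw [← map_smul, smul_eq_mul, mul_one]

/-- The space direction `∂_x`. -/
def dirX : ℝ × ℝ × ℝ := (1, 0, 0)

/-- The light-cone direction `∂_u`. -/
def dirU : ℝ × ℝ × ℝ := (0, 1, 1)

/-- The light-cone direction `∂_v`. -/
def dirV : ℝ × ℝ × ℝ := (0, -1, 1)

theorem wCoordL_dirX (z : ℂ) : wCoordL z dirX = 1 := by simp [wCoordL_apply, wCoord, dirX]

theorem wCoordL_dirU (z : ℂ) : wCoordL z dirU = z := by simp [wCoordL_apply, wCoord, dirU]

theorem wCoordL_dirV (z : ℂ) : wCoordL z dirV = z⁻¹ := by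
  simp [wCoordL_apply, wCoord, dirV]

/-! ### Algebra of dressing the linear system -/

/-- The projection equation satisfied by a dressed projection. -/
theorem projection_equation {n : ℕ} {z : ℂ} {A P P₁ P₂ : Matrix (Fin n) (Fin n) ℂ}
    (hA : Aᴴ = -A) (hP : Pᴴ = P) (hP₁ : P₁ᴴ = P₁) (hP₂ : P₂ᴴ = P₂)
    (h₁ : P₁ = P₁ * P + P * P₁) (h₂ : P₂ = P₂ * P + P * P₂)
    (h : (z • P₁ - P₂) * P = A * P - P * A * P) :
    conj z • P₁ - P₂ = A * P - P * A - (z - conj z) • (P₁ * P) := by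
  -- The adjoint of `h` supplies the other half of the derivative; differentiating P² = P says that
  -- the two halves suffice.
  have h3 : P * (conj z • P₁ - P₂) = P * A * P - P * A := by
    have := congrArg Matrix.conjTranspose h
    simp only [Matrix.conjTranspose_mul, Matrix.conjTranspose_sub, Matrix.conjTranspose_smul, hA,
      hP, hP₁, hP₂] at this
    rw [← starRingEnd_apply] at this
    rw [this]
    noncomm_ring
  calc conj z • P₁ - P₂
      = conj z • (P₁ * P + P * P₁) - (P₂ * P + P * P₂) := by rw [← h₁, ← h₂]
    _ = P * (conj z • P₁ - P₂) + ((z • P₁ - P₂) * P - (z - conj z) • (P₁ * P)) := by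
      simp only [mul_sub, sub_mul, mul_smul_comm, smul_mul_assoc]
      module
    _ = _ := by rw [h, h3]; module

/-- The linear equation for the dressed solution, in terms of the projection equation. -/
theorem dressed_equation {n : ℕ} {z w l b : ℂ} {A P P₁ P₂ ψ ψ₁ ψ₂ : Matrix (Fin n) (Fin n) ℂ}
    (hb : b * (l - w) = z - w) (hψ : l • ψ₁ - ψ₂ = A * ψ)
    (hP : w • P₁ - P₂ = A * P - P * A - (z - w) • (P₁ * P)) :
    l • (-(b • P₁) * ψ + (1 - b • P) * ψ₁) - (-(b • P₂) * ψ + (1 - b • P) * ψ₂)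
      = (A - (z - w) • P₁) * ((1 - b • P) * ψ) := by
  -- Split l = w + (l - w) before P₁. The constant b(l - w) = z - w is what keeps l out of the new
  -- coefficient. In use, w is z̄ and 1 - bP is the soliton factor.
  calc _ = -(b • ((w • P₁ - P₂) * ψ)) - (b * (l - w)) • (P₁ * ψ)
        + (l • ψ₁ - ψ₂) - b • (P * (l • ψ₁ - ψ₂)) := by
        simp only [mul_sub, sub_mul, mul_smul_comm, smul_mul_assoc, neg_mul, one_mul]
        module
    _ = _ := by
      rw [hP, hψ, hb]
      simp only [mul_sub, sub_mul, mul_smul_comm, smul_mul_assoc, one_mul, mul_assoc]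
      module

/-- An extended solution with potential `Q`, regular off the set `S`: it solves the linear system
whose coefficients are `Q_x` and `Q_v`, and it satisfies the unitary reality condition. -/
structure IsExtendedSolution {n : ℕ} (S : Set ℂ) (ψ : ℝ → ℝ → ℝ → ℂ → Matrix (Fin n) (Fin n) ℂ)
    (Q : ℝ × ℝ × ℝ → Matrix (Fin n) (Fin n) ℂ) : Prop where
  smooth : ∀ l ∉ S, ContDiff ℝ ∞ (fun p : ℝ × ℝ × ℝ => ψ p.1 p.2.1 p.2.2 l)
  smooth_potential : ContDiff ℝ ∞ Q
  skew : ∀ p, (Q p)ᴴ = -Q p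
  unitary : ∀ l ∉ S, ∀ x y t, (ψ x y t (conj l))ᴴ * ψ x y t l = 1
  eq_x : ∀ l ∉ S, ∀ p : ℝ × ℝ × ℝ,
    l • dirDeriv dirX (fun p : ℝ × ℝ × ℝ => ψ p.1 p.2.1 p.2.2 l) p
      - dirDeriv dirU (fun p : ℝ × ℝ × ℝ => ψ p.1 p.2.1 p.2.2 l) p
      = dirDeriv dirX Q p * ψ p.1 p.2.1 p.2.2 l
  eq_v : ∀ l ∉ S, ∀ p : ℝ × ℝ × ℝ,
    l • dirDeriv dirV (fun p : ℝ × ℝ × ℝ => ψ p.1 p.2.1 p.2.2 l) p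
      - dirDeriv dirX (fun p : ℝ × ℝ × ℝ => ψ p.1 p.2.1 p.2.2 l) p
      = dirDeriv dirV Q p * ψ p.1 p.2.1 p.2.2 l

theorem hFactor_eq {n : ℕ} {z l : ℂ} (hl : l ≠ conj z) (P : Matrix (Fin n) (Fin n) ℂ) :
    hFactor z P l = 1 - ((z - conj z) / (l - conj z)) • P := by
  have h : l - conj z ≠ 0 := sub_ne_zero.2 hl
  have h2 : (l - z) / (l - conj z) = 1 - (z - conj z) / (l - conj z) := by
    field_simp; ring
  rw [hFactor, h2]
  module

/-- The coefficients of P at l and, after conjugation, at l̄ are reciprocal, and P and 1 - P are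
complementary. -/
theorem hFactor_unitary {n : ℕ} {z l : ℂ} (h1 : l ≠ z) (h2 : l ≠ conj z)
    {P : Matrix (Fin n) (Fin n) ℂ} (hH : Pᴴ = P) (hP : P * P = P) :
    (hFactor z P (conj l))ᴴ * hFactor z P l = 1 := by
  have h3 : l - conj z ≠ 0 := sub_ne_zero.2 h2
  have h4 : l - z ≠ 0 := sub_ne_zero.2 h1
  have h5 : (l - conj z) / (l - z) * ((l - z) / (l - conj z)) = 1 := by field_simp
  simp only [hFactor, Matrix.conjTranspose_add, Matrix.conjTranspose_sub,
    Matrix.conjTranspose_smul, Matrix.conjTranspose_one, hH, ← starRingEnd_apply, map_div₀, map_sub,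
    Complex.conj_conj]
  calc _ = (1 - P) * (1 - P) + ((l - conj z) / (l - z) * ((l - z) / (l - conj z))) • (P * P) := by
        simp only [add_mul, mul_add, sub_mul, mul_sub, smul_mul_assoc, mul_smul_comm, hP, one_mul,
          mul_one]
        module
    _ = 1 := by
        rw [h5]
        simp only [sub_mul, mul_sub, hP, one_mul, mul_one]
        module

/-! ### Bäcklund transformation of extended solutions -/

section Backlund

variable {n k : ℕ} {S : Set ℂ} {ψ : ℝ → ℝ → ℝ → ℂ → Matrix (Fin n) (Fin n) ℂ}
  {Q : ℝ × ℝ × ℝ → Matrix (Fin n) (Fin n) ℂ} {z : ℂ} {V : ℂ → Matrix (Fin n) (Fin k) ℂ}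

/-- The projection `π̃` of the Bäcklund transformation, as a function on space-time. -/
noncomputable def backlundProj (z : ℂ) (V : ℂ → Matrix (Fin n) (Fin k) ℂ)
    (ψ : ℝ → ℝ → ℝ → ℂ → Matrix (Fin n) (Fin n) ℂ) (p : ℝ × ℝ × ℝ) : Matrix (Fin n) (Fin n) ℂ :=
  hermProj (ψ p.1 p.2.1 p.2.2 z * solitonProj z V p.1 p.2.1 p.2.2)

theorem IsExtendedSolution.isUnit (h : IsExtendedSolution S ψ Q) {l : ℂ} (hl : l ∉ S)
    (x y t : ℝ) : IsUnit (ψ x y t l) :=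
  IsUnit.of_mul_eq_one_right _ (h.unitary l hl x y t)

/-- The local holomorphic idempotents behind the projection of the Bäcklund transformation. -/
theorem exists_backlundProj_eq (hV : IsMeromorphicFrame V)
    (ψ : ℝ → ℝ → ℝ → ℂ → Matrix (Fin n) (Fin n) ℂ) (p : ℝ × ℝ × ℝ) :
    ∃ e : ℂ → Matrix (Fin n) (Fin n) ℂ, AnalyticAt ℂ e (wCoordL z p) ∧
      ∀ᶠ q : ℝ × ℝ × ℝ in 𝓝 p, e (wCoordL z q) * e (wCoordL z q) = e (wCoordL z q) ∧
        (∀ c : ℂ, (1 + c • e (wCoordL z q)).det = (1 + c) ^ k) ∧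
        backlundProj z V ψ q = hermProj (ψ q.1 q.2.1 q.2.2 z * e (wCoordL z q)) := by
  obtain ⟨e, he, h⟩ := exists_frameProj_eq hV (wCoordL z p)
  refine ⟨e, he, ?_⟩
  filter_upwards [(wCoordL z).continuous.continuousAt.eventually h] with q hq
  refine ⟨hq.1, hq.2.1, ?_⟩
  rw [backlundProj, solitonProj, ← wCoordL_apply, hq.2.2, hermProj_mul_hermProj _ hq.1]

/-- A Bäcklund transformation multiplies the determinant by `((l - z) / (l - z̄)) ^ k`. -/
theorem det_backlund (h : IsExtendedSolution S ψ Q) (hz : z ∉ S) (hV : IsMeromorphicFrame V)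
    (x y t : ℝ) (l : ℂ) :
    (backlund z V ψ x y t l).det = ((l - z) / (l - conj z)) ^ k * (ψ x y t l).det := by
  obtain ⟨e, -, he⟩ := exists_backlundProj_eq (z := z) hV ψ (x, y, t)
  obtain ⟨h1, h2, h3⟩ := he.self_of_nhds
  rw [backlund, Matrix.det_mul]
  congr 1
  have h4 := (hermProj_mul_idempotent_properties (h.isUnit hz x y t) h1).2.2.2.2
    ((l - z) / (l - conj z) - 1)
  rw [h2] at h4
  have h5 : hermProj (ψ x y t z * solitonProj z V x y t)
      = hermProj (ψ x y t z * e (wCoordL z (x, y, t))) := h3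
  rw [hFactor, h5]
  convert h4 using 2
  · module
  · ring

/-- The Bäcklund transformation of an extended solution is an extended solution. -/
theorem IsExtendedSolution.backlund (h : IsExtendedSolution S ψ Q) (hz : z ∉ S) (hz0 : z ≠ 0)
    (hV : IsMeromorphicFrame V) :
    IsExtendedSolution (S ∪ {z, conj z}) (backlund z V ψ)
      (fun p => Q p - (z - conj z) • backlundProj z V ψ p) := by
  set P := backlundProj z V ψ with hPdef
  have hPall : ∀ p, (P p)ᴴ = P p ∧ P p * P p = P p := by
    intro p
    obtain ⟨e, -, he⟩ := exists_backlundProj_eq (z := z) hV ψ p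
    obtain ⟨h1, -, h3⟩ := he.self_of_nhds
    have h4 := hermProj_mul_idempotent_properties (h.isUnit hz p.1 p.2.1 p.2.2) h1
    rw [← h3] at h4
    exact ⟨h4.1, h4.2.2.2.1⟩
  have hψz := h.smooth z hz
  have hPs : ContDiff ℝ ∞ P := by
    rw [contDiff_iff_contDiffAt]
    intro p
    obtain ⟨e, hea, he⟩ := exists_backlundProj_eq (z := z) hV ψ p
    have h1 : ContDiffAt ℝ ∞ (fun q => e (wCoordL z q)) p :=
      (hea.contDiffAt.restrict_scalars ℝ).comp p (wCoordL z).contDiff.contDiffAt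
    have h2 := contDiffAt_hermProj hψz.contDiffAt h1 (fun q => h.isUnit hz q.1 q.2.1 q.2.2)
      (he.mono fun q hq => hq.1)
    exact h2.congr_of_eventuallyEq (he.mono fun q hq => hq.2.2)
  have hPd : ∀ {p}, DifferentiableAt ℝ P p := hPs.differentiableAt_of_infty
  have hQd : ∀ {p}, DifferentiableAt ℝ Q p := h.smooth_potential.differentiableAt_of_infty
  have hbl : ∀ l, l ≠ conj z → (fun p : ℝ × ℝ × ℝ => Ward.backlund z V ψ p.1 p.2.1 p.2.2 l)
      = fun p => (1 - ((z - conj z) / (l - conj z)) • P p) * ψ p.1 p.2.1 p.2.2 l := by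
    intro l hl
    funext p
    rw [Ward.backlund, ← hFactor_eq hl]
    rfl
  have hS : ∀ {l}, l ∉ S ∪ {z, conj z} → l ∉ S ∧ l ≠ z ∧ l ≠ conj z := by
    intro l hl
    simp only [Set.mem_union, Set.mem_insert_iff, Set.mem_singleton_iff, not_or] at hl
    exact hl
  have hfs : ∀ b : ℂ, ContDiff ℝ ∞ (fun p => 1 - b • P p) := fun b =>
    contDiff_const.sub (hPs.const_smul b)
  -- Both equations have the shape l∂₁ - ∂₂ with w(∂₂) = z w(∂₁), for the pairs (x, u) and (v, x),
  -- so one argument serves both.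
  have key : ∀ v₁ v₂ : ℝ × ℝ × ℝ, wCoordL z v₂ = z * wCoordL z v₁ →
      (∀ l ∉ S, ∀ p : ℝ × ℝ × ℝ,
        l • dirDeriv v₁ (fun p : ℝ × ℝ × ℝ => ψ p.1 p.2.1 p.2.2 l) p
          - dirDeriv v₂ (fun p : ℝ × ℝ × ℝ => ψ p.1 p.2.1 p.2.2 l) p
          = dirDeriv v₁ Q p * ψ p.1 p.2.1 p.2.2 l) →
      ∀ l ∉ S ∪ {z, conj z}, ∀ p : ℝ × ℝ × ℝ,
        l • dirDeriv v₁ (fun p : ℝ × ℝ × ℝ => Ward.backlund z V ψ p.1 p.2.1 p.2.2 l) p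
          - dirDeriv v₂ (fun p : ℝ × ℝ × ℝ => Ward.backlund z V ψ p.1 p.2.1 p.2.2 l) p
          = dirDeriv v₁ (fun p => Q p - (z - conj z) • P p) p
            * Ward.backlund z V ψ p.1 p.2.1 p.2.2 l := by
    intro v₁ v₂ hv hlax l hl p
    obtain ⟨hlS, -, hlz⟩ := hS hl
    have hψl : DifferentiableAt ℝ (fun p : ℝ × ℝ × ℝ => ψ p.1 p.2.1 p.2.2 l) p :=
      (h.smooth l hlS).differentiableAt_of_infty
    have hψzd : DifferentiableAt ℝ (fun p : ℝ × ℝ × ℝ => ψ p.1 p.2.1 p.2.2 z) p :=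
      hψz.differentiableAt_of_infty
    have hd : ∀ v, dirDeriv v (fun p => 1 - ((z - conj z) / (l - conj z)) • P p) p
        = -(((z - conj z) / (l - conj z)) • dirDeriv v P p) := by
      intro v
      rw [dirDeriv_sub (differentiableAt_const _) (hPd.fun_const_smul _), dirDeriv_const,
        dirDeriv_const_smul _ hPd, zero_sub]
    have hskew : (dirDeriv v₁ Q p)ᴴ = -dirDeriv v₁ Q p := by
      rw [← dirDeriv_conjTranspose hQd]
      simp only [h.skew]
      have := dirDeriv_const_smul (v := v₁) (-1) (hQd (p := p))
      simpa using this
    have hHerm : ∀ v, (dirDeriv v P p)ᴴ = dirDeriv v P p := by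
      intro v
      rw [← dirDeriv_conjTranspose hPd]
      simp only [hPall]
    have hidem : ∀ v, dirDeriv v P p = dirDeriv v P p * P p + P p * dirDeriv v P p := by
      intro v
      rw [← dirDeriv_mul hPd hPd]
      simp only [hPall]
    -- M = ψ(z)e(w) spans the image of P. Differentiate PM = M, insert the linear equation for M,
    -- and pass from M to P by P = MX.
    have hproj : (z • dirDeriv v₁ P p - dirDeriv v₂ P p) * P p
        = dirDeriv v₁ Q p * P p - P p * dirDeriv v₁ Q p * P p := by
      obtain ⟨e, hea, he⟩ := exists_backlundProj_eq (z := z) hV ψ p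
      obtain ⟨h1, -, h3⟩ := he.self_of_nhds
      obtain ⟨-, -, ⟨X, hX⟩, -⟩ :=
        hermProj_mul_idempotent_properties (h.isUnit hz p.1 p.2.1 p.2.2) h1
      rw [← h3] at hX
      set M : ℝ × ℝ × ℝ → Matrix (Fin n) (Fin n) ℂ :=
        fun q => ψ q.1 q.2.1 q.2.2 z * e (wCoordL z q) with hM
      have hed : DifferentiableAt ℝ (fun q => e (wCoordL z q)) p :=
        (hea.differentiableAt.restrictScalars ℝ).comp p (wCoordL z).differentiableAt
      have hMd : DifferentiableAt ℝ M p := hψzd.mul hed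
      have hPM : (fun q => P q * M q) =ᶠ[𝓝 p] M := by
        filter_upwards [he] with q hq
        rw [hPdef, hq.2.2]
        exact (hermProj_mul_idempotent_properties (h.isUnit hz q.1 q.2.1 q.2.2) hq.1).2.1
      have hPMd : ∀ v, dirDeriv v P p * M p = dirDeriv v M p - P p * dirDeriv v M p := by
        intro v
        rw [eq_sub_iff_add_eq, ← dirDeriv_mul hPd hMd, dirDeriv_congr hPM]
      -- M inherits the equation of ψ at l = z, since the terms with derivatives of e(w) cancel.
      have hMlax : z • dirDeriv v₁ M p - dirDeriv v₂ M p = dirDeriv v₁ Q p * M p := by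
        have h4 := hlax z hz p
        simp only [hM]
        rw [dirDeriv_mul hψzd hed, dirDeriv_mul hψzd hed,
          dirDeriv_comp_wCoordL hea.differentiableAt, dirDeriv_comp_wCoordL hea.differentiableAt,
          hv, ← mul_assoc, ← h4]
        simp only [sub_mul, smul_mul_assoc, mul_smul_comm]
        module
      have h5 : (z • dirDeriv v₁ P p - dirDeriv v₂ P p) * M p
          = dirDeriv v₁ Q p * M p - P p * (dirDeriv v₁ Q p * M p) := by
        rw [sub_mul, smul_mul_assoc, hPMd, hPMd, ← hMlax]
        simp only [mul_sub, mul_smul_comm]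
        module
      have h6 : P p = M p * X := hX
      calc _ = (z • dirDeriv v₁ P p - dirDeriv v₂ P p) * M p * X := by rw [mul_assoc, ← h6]
        _ = (dirDeriv v₁ Q p * M p - P p * (dirDeriv v₁ Q p * M p)) * X := by rw [h5]
        _ = _ := by
          rw [sub_mul, mul_assoc _ (M p) X, ← h6, ← mul_assoc (P p), mul_assoc _ (M p) X, ← h6]
    have hb : (z - conj z) / (l - conj z) * (l - conj z) = z - conj z :=
      div_mul_cancel₀ _ (sub_ne_zero.2 hlz)
    have hfinal := dressed_equation hb (hlax l hlS p) (projection_equation hskew (hPall p).1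
      (hHerm v₁) (hHerm v₂) (hidem v₁) (hidem v₂) hproj)
    have hblp := congrFun (hbl l hlz) p
    rw [hblp, hbl l hlz, dirDeriv_mul (hfs _).differentiableAt_of_infty hψl,
      dirDeriv_mul (hfs _).differentiableAt_of_infty hψl, hd, hd,
      dirDeriv_sub hQd (hPd.fun_const_smul _), dirDeriv_const_smul _ hPd]
    exact hfinal
  refine ⟨fun l hl => ?_, ?_, fun p => ?_, fun l hl x y t => ?_, ?_, ?_⟩
  · obtain ⟨h1, -, h3⟩ := hS hl
    rw [hbl l h3]
    exact (hfs _).mul (h.smooth l h1)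
  · exact h.smooth_potential.sub (hPs.const_smul _)
  · rw [Matrix.conjTranspose_sub, Matrix.conjTranspose_smul, (hPall p).1, h.skew p,
      ← starRingEnd_apply, map_sub, Complex.conj_conj]
    module
  · obtain ⟨h1, h2, h3⟩ := hS hl
    have h4 := hFactor_unitary h2 h3 (hPall (x, y, t)).1 (hPall (x, y, t)).2
    rw [Ward.backlund, Ward.backlund, Matrix.conjTranspose_mul, mul_assoc, ← mul_assoc _ _ (ψ x y t l)]
    refine Eq.trans ?_ (h.unitary l h1 x y t)
    congr 1
    refine (congrArg (· * ψ x y t l) h4).trans (one_mul _)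
  · exact key dirX dirU (by rw [wCoordL_dirX, wCoordL_dirU, mul_one]) h.eq_x
  · exact key dirV dirX (by rw [wCoordL_dirX, wCoordL_dirV, mul_inv_cancel₀ hz0]) h.eq_v

/-- The extended `1`-soliton is the Bäcklund transformation of the constant solution. -/
theorem extSoliton_eq_backlund (z : ℂ) (hV : IsMeromorphicFrame V) :
    extSoliton z V = backlund z V (fun _ _ _ _ => 1) := by
  funext x y t l
  obtain ⟨e, -, h⟩ := exists_frameProj_eq hV (wCoord z x y t)
  obtain ⟨h1, -, h3⟩ := h.self_of_nhds
  have h4 := hermProj_mul_hermProj 1 h1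
  rw [one_mul] at h4
  simp only [extSoliton, backlund, solitonProj, h3, h4, one_mul, mul_one]

/-- The seed of the induction: the 1-soliton then needs no treatment of its own. -/
theorem isExtendedSolution_one :
    IsExtendedSolution (n := n) ∅ (fun _ _ _ _ => 1) (fun _ => 0) := by
  refine ⟨fun _ _ => contDiff_const, contDiff_const, ?_, ?_, ?_, ?_⟩ <;>
    simp [dirDeriv_const]

end Backlund

/-! ### From a potential to the Ward equation -/

section WardEquation

variable {n : ℕ} {F : ℝ × ℝ × ℝ → Matrix (Fin n) (Fin n) ℂ}

/-- The space direction `∂_y`. -/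
def dirY : ℝ × ℝ × ℝ := (0, 1, 0)

/-- The time direction `∂_t`. -/
def dirT : ℝ × ℝ × ℝ := (0, 0, 1)

theorem deriv_entry_eq_dirDeriv {p v : ℝ × ℝ × ℝ} {c : ℝ → ℝ × ℝ × ℝ} {s : ℝ}
    (hF : DifferentiableAt ℝ F p) (hc : HasDerivAt c v s) (hp : c s = p) (a b : Fin n) :
    deriv (fun r => F (c r) a b) s = dirDeriv v F p a b := by
  subst hp
  have h1 := hF.hasFDerivAt.comp_hasDerivAt s hc
  have h2 := (LinearMap.toContinuousLinearMap
    (Matrix.entryLinearMap ℝ ℂ a b : Matrix (Fin n) (Fin n) ℂ →ₗ[ℝ] ℂ)).hasFDerivAt.comp_hasDerivAt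
      s h1
  exact h2.deriv

theorem dx_eq (hF : ContDiff ℝ ∞ F) (x y t : ℝ) :
    dx (fun x y t => F (x, y, t)) x y t = dirDeriv dirX F (x, y, t) := by
  ext a b
  exact deriv_entry_eq_dirDeriv (c := fun s => (s, y, t)) hF.differentiableAt_of_infty
    ((hasDerivAt_id x).prodMk ((hasDerivAt_const x y).prodMk (hasDerivAt_const x t))) rfl a b

theorem dy_eq (hF : ContDiff ℝ ∞ F) (x y t : ℝ) :
    dy (fun x y t => F (x, y, t)) x y t = dirDeriv dirY F (x, y, t) := by
  ext a b
  exact deriv_entry_eq_dirDeriv (c := fun s => (x, s, t)) hF.differentiableAt_of_infty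
    ((hasDerivAt_const y x).prodMk ((hasDerivAt_id y).prodMk (hasDerivAt_const y t))) rfl a b

theorem dt_eq (hF : ContDiff ℝ ∞ F) (x y t : ℝ) :
    dt (fun x y t => F (x, y, t)) x y t = dirDeriv dirT F (x, y, t) := by
  ext a b
  exact deriv_entry_eq_dirDeriv (c := fun s => (x, y, s)) hF.differentiableAt_of_infty
    ((hasDerivAt_const t x).prodMk ((hasDerivAt_const t y).prodMk (hasDerivAt_id t))) rfl a b

theorem dirU_eq : dirU = dirT + dirY := by simp [dirU, dirT, dirY]

theorem dirV_eq : dirV = dirT - dirY := by simp [dirV, dirT, dirY]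

/-- If the light-cone components `J⁻¹ J_u`, `J⁻¹ J_x` of a smooth invertible map are the
derivatives `Q_x`, `Q_v` of a potential, then the map solves the Ward equation. -/
theorem wardEquation_of_potential {J Ψ Q : ℝ × ℝ × ℝ → Matrix (Fin n) (Fin n) ℂ}
    (hJ : ContDiff ℝ ∞ J) (hΨ : ContDiff ℝ ∞ Ψ) (hQ : ContDiff ℝ ∞ Q) (hΨJ : ∀ p, Ψ p * J p = 1)
    (hu : ∀ p, Ψ p * dirDeriv dirU J p = dirDeriv dirX Q p)
    (hx : ∀ p, Ψ p * dirDeriv dirX J p = dirDeriv dirV Q p) :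
    WardEquation (fun x y t => J (x, y, t)) := by
  have hinv : ∀ p, (J p)⁻¹ = Ψ p := fun p => Matrix.inv_eq_left_inv (hΨJ p)
  have hJd : ∀ {p}, DifferentiableAt ℝ J p := hJ.differentiableAt_of_infty
  have hΨd : ∀ {p}, DifferentiableAt ℝ Ψ p := hΨ.differentiableAt_of_infty
  have hK : ∀ v, ContDiff ℝ ∞ (fun p => Ψ p * dirDeriv v J p) := fun v =>
    hΨ.mul (contDiff_dirDeriv hJ v)
  have hKd : ∀ {v p}, DifferentiableAt ℝ (fun p => Ψ p * dirDeriv v J p) p := fun {v p} =>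
    (hK v).differentiableAt_of_infty
  have hΨ' : ∀ v p, dirDeriv v Ψ p = -(Ψ p * dirDeriv v J p * Ψ p) := by
    intro v p
    have h1 : dirDeriv v Ψ p * J p + Ψ p * dirDeriv v J p = 0 := by
      rw [← dirDeriv_mul hΨd hJd]
      simp only [hΨJ, dirDeriv_const]
    have h2 : J p * Ψ p = 1 := mul_eq_one_comm.1 (hΨJ p)
    calc dirDeriv v Ψ p = dirDeriv v Ψ p * J p * Ψ p := by rw [mul_assoc, h2, mul_one]
      _ = _ := by rw [eq_neg_of_add_eq_zero_left h1, neg_mul]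
  -- J⁻¹dJ is a flat connection: its components K satisfy ∂_v K_w - ∂_w K_v = [K_w, K_v].
  have hcurv : ∀ v w p, dirDeriv v (fun p => Ψ p * dirDeriv w J p) p
      - dirDeriv w (fun p => Ψ p * dirDeriv v J p) p
      = Ψ p * dirDeriv w J p * (Ψ p * dirDeriv v J p)
        - Ψ p * dirDeriv v J p * (Ψ p * dirDeriv w J p) := by
    intro v w p
    have hd : ∀ v, DifferentiableAt ℝ (dirDeriv v J) p := fun v =>
      (contDiff_dirDeriv hJ v).differentiableAt_of_infty
    rw [dirDeriv_mul hΨd (hd w), dirDeriv_mul hΨd (hd v), dirDeriv_comm hJ (v := v) (w := w), hΨ',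
      hΨ']
    noncomm_ring
  have h1 : (fun x y t => (J (x, y, t))⁻¹ * dt (fun x y t => J (x, y, t)) x y t)
      = fun x y t => (fun p => Ψ p * dirDeriv dirT J p) (x, y, t) := by
    funext x y t
    rw [dt_eq hJ, hinv]
  have h2 : (fun x y t => (J (x, y, t))⁻¹ * dx (fun x y t => J (x, y, t)) x y t)
      = fun x y t => (fun p => Ψ p * dirDeriv dirX J p) (x, y, t) := by
    funext x y t
    rw [dx_eq hJ, hinv]
  have h3 : (fun x y t => (J (x, y, t))⁻¹ * dy (fun x y t => J (x, y, t)) x y t)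
      = fun x y t => (fun p => Ψ p * dirDeriv dirY J p) (x, y, t) := by
    funext x y t
    rw [dy_eq hJ, hinv]
  intro x y t
  rw [h1, h2, h3, dt_eq (hK _), dx_eq (hK _), dy_eq (hK _), dt_eq hJ, dy_eq hJ, hinv]
  have h4 := hcurv dirT dirY (x, y, t)
  -- The light-cone form (J⁻¹J_u)_v = (J⁻¹J_x)_x; both sides are mixed second derivatives of Q.
  have h5 : dirDeriv dirV (fun p => Ψ p * dirDeriv dirU J p) (x, y, t)
      = dirDeriv dirX (fun p => Ψ p * dirDeriv dirX J p) (x, y, t) := by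
    rw [funext hu, funext hx]
    exact dirDeriv_comm hQ
  have h6 : (fun p => Ψ p * dirDeriv dirU J p)
      = fun p => Ψ p * dirDeriv dirT J p - (-1 : ℂ) • (Ψ p * dirDeriv dirY J p) := by
    funext p
    rw [dirU_eq, dirDeriv_add_dir, mul_add]
    module
  rw [h6, dirDeriv_sub hKd (hKd.fun_const_smul _), dirDeriv_const_smul _ hKd, dirV_eq,
    dirDeriv_sub_dir, dirDeriv_sub_dir] at h5
  -- Expanding (∂_t - ∂_y)(K_t + K_y), the cross terms ∂_t K_y - ∂_y K_t form the commutator of the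
  -- Ward equation.
  rw [← h5, ← neg_sub (_ * (_ * dirDeriv dirT J _)), ← h4]
  module

end WardEquation

/-- The Ward map of an extended solution that is regular at `0`. -/
theorem IsExtendedSolution.isWardMap {n : ℕ} {S : Set ℂ}
    {ψ : ℝ → ℝ → ℝ → ℂ → Matrix (Fin n) (Fin n) ℂ} {Q : ℝ × ℝ × ℝ → Matrix (Fin n) (Fin n) ℂ}
    (h : IsExtendedSolution S ψ Q) (h0 : (0 : ℂ) ∉ S) {c : ℂ} (hc : conj c * c = 1)
    (hdet : ∀ x y t, c ^ n = (ψ x y t 0).det) :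
    IsWardMap (fun x y t => c • (ψ x y t 0)⁻¹) := by
  set Ψ : ℝ × ℝ × ℝ → Matrix (Fin n) (Fin n) ℂ := fun p => ψ p.1 p.2.1 p.2.2 0
  have hc0 : c ≠ 0 := right_ne_zero_of_mul_eq_one hc
  -- Zero is its own conjugate, so the reality condition there is unitarity.
  have hun : ∀ p, (Ψ p)ᴴ * Ψ p = 1 := by
    intro p
    have := h.unitary 0 h0 p.1 p.2.1 p.2.2
    rwa [map_zero] at this
  have hinv : ∀ p, (Ψ p)⁻¹ = (Ψ p)ᴴ := fun p => Matrix.inv_eq_left_inv (hun p)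
  have hun' : ∀ p, Ψ p * (Ψ p)ᴴ = 1 := fun p => mul_eq_one_comm.1 (hun p)
  have hΨs : ContDiff ℝ ∞ Ψ := h.smooth 0 h0
  have hΨHs : ContDiff ℝ ∞ (fun p => (Ψ p)ᴴ) := contDiff_iff_contDiffAt.2 fun p =>
    contDiffAt_conjTranspose hΨs.contDiffAt
  have hJs : ContDiff ℝ ∞ (fun p => c • (Ψ p)ᴴ) := hΨHs.const_smul c
  have hJ : (fun x y t => c • (ψ x y t 0)⁻¹)
      = fun x y t => (fun p => c • (Ψ p)ᴴ) (x, y, t) := by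
    funext x y t
    exact congrArg (c • ·) (hinv (x, y, t))
  have hder : ∀ v p, Ψ p * dirDeriv v (fun p => (Ψ p)ᴴ) p = -(dirDeriv v Ψ p * (Ψ p)ᴴ) := by
    intro v p
    rw [eq_neg_iff_add_eq_zero, add_comm,
      ← dirDeriv_mul hΨs.differentiableAt_of_infty hΨHs.differentiableAt_of_infty]
    simp only [hun', dirDeriv_const]
  have hlax : ∀ v p, (c⁻¹ • Ψ p) * dirDeriv v (fun p => c • (Ψ p)ᴴ) p
      = -(dirDeriv v Ψ p * (Ψ p)ᴴ) := by
    intro v p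
    rw [dirDeriv_const_smul _ hΨHs.differentiableAt_of_infty, smul_mul_smul_comm,
      inv_mul_cancel₀ hc0, one_smul, hder]
  rw [hJ]
  refine ⟨contDiff_entry hJs, fun x y t => ?_, ?_⟩
  · rw [Matrix.mem_specialUnitaryGroup_iff, Matrix.mem_unitaryGroup_iff']
    refine ⟨?_, ?_⟩
    · show star (c • (Ψ (x, y, t))ᴴ) * (c • (Ψ (x, y, t))ᴴ) = 1
      rw [Matrix.star_eq_conjTranspose, Matrix.conjTranspose_smul,
        Matrix.conjTranspose_conjTranspose, smul_mul_smul_comm, hun', ← starRingEnd_apply, hc,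
        one_smul]
    · show (c • (Ψ (x, y, t))ᴴ).det = 1
      have h1 : c ^ n = (Ψ (x, y, t)).det := hdet x y t
      rw [Matrix.det_smul, Fintype.card_fin, h1, ← Matrix.det_mul, hun', Matrix.det_one]
  · refine wardEquation_of_potential (J := fun p => c • (Ψ p)ᴴ) (Ψ := fun p => c⁻¹ • Ψ p) (Q := Q) hJs (hΨs.const_smul _)
      h.smooth_potential (fun p => ?_) (fun p => ?_) fun p => ?_
    · rw [smul_mul_smul_comm, inv_mul_cancel₀ hc0, one_smul, hun']
    · have h1 := h.eq_x 0 h0 p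
      rw [zero_smul, zero_sub] at h1
      rw [hlax, ← neg_mul, h1, mul_assoc, hun', mul_one]
    · have h1 := h.eq_v 0 h0 p
      rw [zero_smul, zero_sub] at h1
      rw [hlax, ← neg_mul, h1, mul_assoc, hun', mul_one]

/-! ### Iterated Bäcklund transformations -/

section Multi

variable {n : ℕ} {z : ℕ → ℂ} {k : ℕ → ℕ} {V : (i : ℕ) → ℂ → Matrix (Fin n) (Fin (k i)) ℂ}

/-- The iterated Bäcklund transformations are extended solutions with the expected determinant. -/
theorem isExtendedSolution_multiPsi (N : ℕ) (hz : ∀ i ≤ N, z i ≠ 0)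
    (hne : ∀ i ≤ N, ∀ j ≤ N, i ≠ j → z i ≠ z j ∧ z i ≠ conj (z j))
    (hV : ∀ i ≤ N, IsMeromorphicFrame (V i)) :
    (∃ Q, IsExtendedSolution {l | ∃ i ≤ N, l = z i ∨ l = conj (z i)} (multiPsi z V N) Q) ∧
      ∀ x y t, (multiPsi z V N x y t 0).det
        = ∏ i ∈ Finset.range (N + 1), (z i / conj (z i)) ^ k i := by
  induction N with
  | zero =>
    have h1 := isExtendedSolution_one (n := n)
    have hV0 := hV 0 le_rfl
    have h2 := h1.backlund (Set.notMem_empty (z 0)) (hz 0 le_rfl) hV0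
    have h3 : multiPsi z V 0 = backlund (z 0) (V 0) (fun _ _ _ _ => 1) :=
      extSoliton_eq_backlund (z 0) hV0
    refine ⟨?_, fun x y t => ?_⟩
    · have h4 : {l | ∃ i ≤ 0, l = z i ∨ l = conj (z i)} = ∅ ∪ {z 0, conj (z 0)} := by
        ext l
        simp
      rw [h3, h4]
      exact ⟨_, h2⟩
    · rw [h3, det_backlund h1 (Set.notMem_empty _) hV0]
      simp
  | succ N ih =>
    obtain ⟨⟨Q, hQ⟩, hdet⟩ := ih (fun i hi => hz i (by lia))
      (fun i hi j hj => hne i (by lia) j (by lia)) (fun i hi => hV i (by lia))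
    -- The new pole must be a regular point of the previous solution, which is evaluated there; this
    -- is where distinctness from the earlier poles and their conjugates enters.
    have hzS : z (N + 1) ∉ {l | ∃ i ≤ N, l = z i ∨ l = conj (z i)} := by
      rintro ⟨i, hi, h⟩
      have := hne (N + 1) le_rfl i (by lia) (by lia)
      tauto
    refine ⟨?_, fun x y t => ?_⟩
    · have h4 : {l | ∃ i ≤ N + 1, l = z i ∨ l = conj (z i)}
          = {l | ∃ i ≤ N, l = z i ∨ l = conj (z i)} ∪ {z (N + 1), conj (z (N + 1))} := by
        ext l
        simp only [Set.mem_ofPred_eq, Set.mem_union, Set.mem_insert_iff, Set.mem_singleton_iff]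
        constructor
        · rintro ⟨i, hi, h⟩
          rcases Nat.le_succ_iff.1 hi with h1 | rfl
          · exact Or.inl ⟨i, h1, h⟩
          · exact Or.inr h
        · rintro (⟨i, hi, h⟩ | h)
          · exact ⟨i, by lia, h⟩
          · exact ⟨N + 1, le_rfl, h⟩
      rw [h4]
      exact ⟨_, hQ.backlund hzS (hz _ le_rfl) (hV _ le_rfl)⟩
    · rw [Finset.prod_range_succ, ← hdet x y t, multiPsi,
        det_backlund hQ hzS (hV _ le_rfl), mul_comm]
      simp

/-- The iterated Bäcklund transformation depends only on the values of the projections. -/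
theorem multiPsi_congr (N : ℕ) {x y t x' y' t' : ℝ}
    (h : ∀ i ≤ N, solitonProj (z i) (V i) x y t = solitonProj (z i) (V i) x' y' t') (l : ℂ) :
    multiPsi z V N x y t l = multiPsi z V N x' y' t' l := by
  -- The inductive step needs the previous solution at z (N + 1) as well as at l.
  induction N generalizing l with
  | zero => simp only [multiPsi, extSoliton, h 0 le_rfl]
  | succ N ih =>
    have h1 := ih fun i hi => h i (by lia)
    simp only [multiPsi, backlund, h (N + 1) le_rfl, h1]

end Multi

/-! ### Periods -/

section Periods

/-- The projection of a doubly periodic extended soliton is doubly periodic. -/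
theorem solitonProj_doublyPeriodic {n k : ℕ} {z : ℂ} {V : ℂ → Matrix (Fin n) (Fin k) ℂ}
    (h : ∀ l : ℂ, DoublyPeriodic (fun x y t => extSoliton z V x y t l)) :
    DoublyPeriodic (solitonProj z V) := by
  -- At l = z the coefficient of the projection vanishes, leaving 1 - π.
  have h1 := h z
  simpa [DoublyPeriodic, extSoliton, hFactor] using h1

theorem norm_sub_inv_ne_zero {z : ℂ} (hz : z ≠ 0) (h : ‖z‖ ≠ 1) : ‖z‖ - ‖z‖⁻¹ ≠ 0 := by
  have h0 : 0 < ‖z‖ := norm_pos_iff.2 hz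
  intro h1
  have h2 : ‖z‖ * ‖z‖ = 1 := by
    field_simp at h1
    nlinarith
  exact h (by nlinarith)

theorem cos_arg_ne_zero_of_norm_eq_one {z : ℂ} (h : ‖z‖ = 1) (h1 : z ≠ Complex.I)
    (h2 : z ≠ -Complex.I) : Real.cos z.arg ≠ 0 := by
  intro hc
  have hre : z.re = 0 := by rw [← Complex.norm_mul_cos_arg, hc, mul_zero]
  have him : z.im * z.im = 1 := by
    have := Complex.normSq_apply z
    rw [Complex.normSq_eq_norm_sq, h, hre] at this
    linarith
  rcases mul_self_eq_one_iff.1 him with h3 | h3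
  · exact h1 (Complex.ext (by simpa using hre) (by simpa using h3))
  · exact h2 (Complex.ext (by simpa using hre) (by simpa using h3))

/-- Translation by `timePeriod z` in time has the same effect on `w` as a lattice translation. -/
theorem timePeriod_spec {z : ℂ} (hz : z ∈ poleSet) :
    timePeriod z ≠ 0 ∧ ∃ a b : ℤ, ∀ x y t : ℝ,
      wCoord z x y (t + timePeriod z)
        = wCoord z (x + a * (2 * Real.pi)) (y + b * (2 * Real.pi)) t := by
  have hz0 : z ≠ 0 := by
    rintro rfl
    exact hz.1 rfl
  have hr : 0 < ‖z‖ := norm_pos_iff.2 hz0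
  have hre := Complex.norm_mul_cos_arg z
  have him := Complex.norm_mul_sin_arg z
  have hpi := Real.pi_ne_zero
  have hire : (z⁻¹).re = Real.cos z.arg / ‖z‖ := by
    rw [Complex.inv_re, Complex.normSq_eq_norm_sq, ← hre]
    field_simp
  have hiim : (z⁻¹).im = -(Real.sin z.arg / ‖z‖) := by
    rw [Complex.inv_im, Complex.normSq_eq_norm_sq, ← him]
    field_simp
  -- The hypotheses are twice the real and imaginary parts of w(0, 0, T) = w(2πa, 2πb, 0).
  have key : ∀ (T : ℝ) (a b : ℤ),
      (‖z‖ + ‖z‖⁻¹) * Real.cos z.arg * T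
        = 2 * (a * (2 * Real.pi)) + (‖z‖ - ‖z‖⁻¹) * Real.cos z.arg * (b * (2 * Real.pi)) →
      (‖z‖ - ‖z‖⁻¹) * Real.sin z.arg * T
        = (‖z‖ + ‖z‖⁻¹) * Real.sin z.arg * (b * (2 * Real.pi)) →
      ∀ x y t : ℝ, wCoord z x y (t + T)
        = wCoord z (x + a * (2 * Real.pi)) (y + b * (2 * Real.pi)) t := by
    intro T a b h1 h2 x y t
    apply Complex.ext
    · simp only [wCoord, Complex.add_re, Complex.re_mul_ofReal, Complex.ofReal_re, hire, ← hre]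
      linear_combination h1 / 2
    · simp only [wCoord, Complex.add_im, Complex.im_mul_ofReal, Complex.ofReal_im, hiim, ← him]
      linear_combination h2 / 2
  by_cases h1 : ‖z‖ = 1
  · have hc : Real.cos z.arg ≠ 0 := by
      rcases hz.2 with h | h
      · exact cos_arg_ne_zero_of_norm_eq_one h1 h.2.1 h.2.2
      · exact absurd h1 h.1
    rw [timePeriod, if_pos h1]
    -- For r = 1 the imaginary equation forces b = 0, and the real one becomes T cos θ = 2πa.
    refine ⟨by positivity, 1, 0, key _ _ _ ?_ ?_⟩
    · rw [h1]; field_simp; norm_num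
    · rw [h1]; simp
  · have hd := norm_sub_inv_ne_zero hz0 h1
    have hq : ∃ q : ℚ, 2 * Real.cos z.arg / (‖z‖ - ‖z‖⁻¹) = (q : ℝ) := by
      rcases hz.2 with h | ⟨-, q, h⟩
      · exact absurd h.1 h1
      · exact ⟨2 * q, by push_cast; rw [← h]; ring⟩
    rw [timePeriod, if_neg h1, dif_pos hq]
    have hspec := Classical.choose_spec hq
    set q := Classical.choose hq
    have hden : (q.den : ℝ) ≠ 0 := by exact_mod_cast q.den_ne_zero
    have hs : ‖z‖ + ‖z‖⁻¹ ≠ 0 := by positivity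
    have hqr : (q : ℝ) * q.den = q.num := by exact_mod_cast Rat.mul_den_eq_num q
    have hcq : 2 * Real.cos z.arg * q.den = q.num * (‖z‖ - ‖z‖⁻¹) := by
      rw [div_eq_iff hd] at hspec
      linear_combination (q.den : ℝ) * hspec + (‖z‖ - ‖z‖⁻¹) * hqr
    have hsd : (‖z‖ + ‖z‖⁻¹) * (‖z‖ + ‖z‖⁻¹) = (‖z‖ - ‖z‖⁻¹) * (‖z‖ - ‖z‖⁻¹) + 4 := by
      have : ‖z‖ * ‖z‖⁻¹ = 1 := mul_inv_cancel₀ hr.ne'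
      linear_combination 4 * this
    have hreal : ∀ s d c m₁ m₂ : ℝ, d ≠ 0 → s * s = d * d + 4 → 2 * c * m₂ = m₁ * d →
        s * c * (2 * Real.pi * m₂ * s / d)
          = 2 * (m₁ * (2 * Real.pi)) + d * c * (m₂ * (2 * Real.pi)) := by
      intro s d c m₁ m₂ hd h1 h2
      field_simp
      linear_combination (c * m₂) * h1 + 2 * h2
    -- The imaginary equation gives T = 2πb(r + r⁻¹)/(r - r⁻¹). By (r + r⁻¹)² - (r - r⁻¹)² = 4 the
    -- real one then becomes 2cos θ/(r - r⁻¹) = a/b, solved by numerator and denominator of q.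
    refine ⟨div_ne_zero (mul_ne_zero (mul_ne_zero (mul_ne_zero two_ne_zero hpi) hden) hs) hd,
      q.num, q.den, key _ _ _ ?_ ?_⟩
    · rw [Int.cast_natCast]
      exact hreal _ _ _ _ _ hd hsd hcq
    · rw [Int.cast_natCast, mul_comm (‖z‖ - ‖z‖⁻¹), mul_assoc, mul_div_cancel₀ _ hd]
      ring

/-- The projection of a doubly periodic extended soliton has the time period `timePeriod z`. -/
theorem solitonProj_timePeriodic {n k : ℕ} {z : ℂ} {V : ℂ → Matrix (Fin n) (Fin k) ℂ}
    (hz : z ∈ poleSet) (h : DoublyPeriodic (solitonProj z V)) (x y : ℝ) :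
    Function.Periodic (fun t => solitonProj z V x y t) (timePeriod z) := by
  obtain ⟨-, a, b, hab⟩ := timePeriod_spec hz
  intro t
  have hx : ∀ y t, Function.Periodic (fun x => solitonProj z V x y t) (2 * Real.pi) :=
    fun y t x => (h x y t).1
  have hy : ∀ x t, Function.Periodic (fun y => solitonProj z V x y t) (2 * Real.pi) :=
    fun x t y => (h x y t).2
  calc solitonProj z V x y (t + timePeriod z)
      = solitonProj z V (x + a * (2 * Real.pi)) (y + b * (2 * Real.pi)) t := by
        rw [solitonProj, hab]; rfl
    _ = solitonProj z V x (y + b * (2 * Real.pi)) t := (hx _ t).int_mul a x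
    _ = solitonProj z V x y t := (hy x t).int_mul b y

/-- Finitely many periods with rational quotients have a common multiple. -/
theorem exists_common_period {N : ℕ} {T : ℕ → ℝ} (hT : ∀ j ≤ N, T j ≠ 0)
    (hq : ∀ j ≤ N, ∃ q : ℚ, T j / T 0 = (q : ℝ)) :
    ∃ P : ℝ, 0 < P ∧ ∀ j ≤ N, ∃ m : ℤ, P = m * T j := by
  choose! q hq using hq
  have h0 := hT 0 (Nat.zero_le _)
  have h1 : ∀ j ≤ N, T 0 * (q j).num = T j * (q j).den := by
    intro j hj
    have h2 : ((q j : ℚ) : ℝ) * (q j).den = (q j).num := by exact_mod_cast Rat.mul_den_eq_num (q j)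
    rw [← h2, ← hq j hj]
    field_simp
  have hnum : ∀ j ≤ N, (q j).num ≠ 0 := by
    intro j hj h2
    have h3 := h1 j hj
    rw [h2, Int.cast_zero, mul_zero] at h3
    exact mul_ne_zero (hT j hj) (by exact_mod_cast (q j).den_ne_zero) h3.symm
  -- T_0 num_j = T_j den_j, so multiplying T_0 by all numerators gives an integer multiple of every
  -- T_j.
  set M : ℤ := ∏ j ∈ Finset.range (N + 1), (q j).num with hM
  have hM0 : M ≠ 0 := Finset.prod_ne_zero_iff.2 fun j hj => hnum j (by
    have := Finset.mem_range.1 hj; lia)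
  have h2 : ∀ j ≤ N, ∃ m : ℤ, T 0 * M = m * T j := by
    intro j hj
    obtain ⟨c, hc⟩ : (q j).num ∣ M := Finset.dvd_prod_of_mem _ (Finset.mem_range.2 (by lia))
    refine ⟨c * (q j).den, ?_⟩
    rw [hc]
    push_cast
    linear_combination (c : ℝ) * h1 j hj
  have h3 : T 0 * M ≠ 0 := mul_ne_zero h0 (by exact_mod_cast hM0)
  -- The numbers T_j may be negative, hence the absolute value.
  refine ⟨|T 0 * M|, abs_pos.2 h3, fun j hj => ?_⟩
  obtain ⟨m, hm⟩ := h2 j hj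
  rcases abs_choice (T 0 * M) with h | h
  · exact ⟨m, by rw [h, hm]⟩
  · exact ⟨-m, by rw [h, hm]; push_cast; ring⟩

end Periods

end Ward

/-! ### The main theorem -/

theorem mainTheorem2 (n N : ℕ) (z : ℕ → ℂ) (k : ℕ → ℕ)
    (V : (i : ℕ) → ℂ → Matrix (Fin n) (Fin (k i)) ℂ)
    (hz : ∀ i ≤ N, z i ∈ Ward.poleSet)
    (hne : ∀ i ≤ N, ∀ j ≤ N, i ≠ j → z i ≠ z j ∧ z i ≠ (starRingEnd ℂ) (z j))
    (hV : ∀ i ≤ N, Ward.IsMeromorphicFrame (V i))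
    (hper : ∀ i ≤ N, ∀ l : ℂ,
      Ward.DoublyPeriodic (fun x y t => Ward.extSoliton (z i) (V i) x y t l))
    (hT : ∀ j ≤ N, ∃ q : ℚ, Ward.timePeriod (z j) / Ward.timePeriod (z 0) = (q : ℝ)) :
    Ward.IsWardMap (Ward.multiWard z V N) ∧
      Ward.DoublyPeriodic (Ward.multiWard z V N) ∧
      Ward.TimePeriodic (Ward.multiWard z V N) := by
  have hz0 : ∀ i ≤ N, z i ≠ 0 := by
    intro i hi h
    exact (hz i hi).1 (by rw [h, Complex.zero_im])
  obtain ⟨⟨Q, hQ⟩, hdet⟩ := Ward.isExtendedSolution_multiPsi N hz0 hne hV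
  have hP := fun i hi => Ward.solitonProj_doublyPeriodic (hper i hi)
  refine ⟨?_, fun x y t => ⟨?_, ?_⟩, ?_⟩
  · refine hQ.isWardMap ?_ ?_ fun x y t => ?_
    · rintro ⟨i, hi, h | h⟩
      · exact hz0 i hi h.symm
      · exact hz0 i hi ((map_eq_zero _).1 h.symm)
    -- Each factor is a real power of z_i/z̄_i, which has modulus 1.
    · rw [Complex.conj_mul', norm_prod, Finset.prod_eq_one, Complex.ofReal_one, one_pow]
      intro i hi
      have hi' : i ≤ N := by have := Finset.mem_range.1 hi; lia
      have h1 : (k i : ℂ) / (n : ℂ) = (((k i : ℝ) / (n : ℝ) : ℝ) : ℂ) := by push_cast; rfl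
      rw [h1, Complex.norm_cpow_real, norm_div, Complex.norm_conj,
        div_self (norm_ne_zero_iff.2 (hz0 i hi')), Real.one_rpow]
    -- For n = 0 the exponent k/n is a junk value, but both sides are 1. For n > 0 the n-th power of
    -- a principal power with exponent k/n is the k-th power, whatever the branch.
    · rcases Nat.eq_zero_or_pos n with rfl | hn
      · simp
      · rw [hdet, ← Finset.prod_pow]
        refine Finset.prod_congr rfl fun i _ => ?_
        rw [← Complex.cpow_mul_nat, div_mul_cancel₀ _ (by exact_mod_cast hn.ne'),
          Complex.cpow_natCast]
  · simp only [Ward.multiWard]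
    rw [Ward.multiPsi_congr N fun i hi => (hP i hi x y t).1]
  · simp only [Ward.multiWard]
    rw [Ward.multiPsi_congr N fun i hi => (hP i hi x y t).2]
  · obtain ⟨T, hT0, hTj⟩ := Ward.exists_common_period
      (fun j hj => (Ward.timePeriod_spec (hz j hj)).1) hT
    refine ⟨T, hT0, fun x y t => ?_⟩
    simp only [Ward.multiWard]
    rw [Ward.multiPsi_congr N fun i hi => ?_]
    obtain ⟨m, hm⟩ := hTj i hi
    rw [hm]
    exact (Ward.solitonProj_timePeriodic (hz i hi) (hP i hi) x y).int_mul m t
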